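/- Fix $T>0$, $\beta^\star\in\mathbb R$, $\theta^\star>0$, and let $X_t=\beta^\star t+\sqrt{\theta^\star}\,W_t+J_t$, $t\in[0,T]$, on a probability space with probability $P^\star$, where $W$ is a standard Brownian motion and $J$ is a pure jump process with, almost surely, finitely many jumps in $[0,T]$, each of finite size (so that $J$ moves only by its jumps), independent of $W$. Let $[J]=\sum_{s\le T}(J_s-J_{s-})^2$ and $\theta^\dagger=\theta^\star+T^{-1}[J]$. For $n\ge1$ put $t_i=iT/n$, $\Delta_n=T/n$, $D_i=X_{t_i}-X_{t_{i-1}}$ ($1\le i\le n$) and \[ L_n(\theta)=\theta^{-n/2}\exp\Bigl\{-\frac{1}{2\Delta_n\theta}\sum_{i=1}^nD_i^2\Bigr\},\qquad \hat\theta_n=T^{-1}\sum_{i=1}^nD_i^2 . \] Let $\pi$ be a probability density on $(0,\infty)$, let $(\kappa_n)$ be a sequence of real random variables, and let \[ \Pi_n(A)=\frac{\int_AL_n(\theta)^{1/\kappa_n}\pi(\theta)\,d\theta}{\int_0^\infty L_n(\theta)^{1/\kappa_n}\pi(\theta)\,d\theta},\qquad A\subseteq(0,\infty). \] Let $P^\star_J$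 denote the conditional distribution, given $J$, of $(D_1,\dots,D_n,\kappa_n)$, and let $d$ be the total variation distance. (a) For $P^\star$-almost every path $J$ the following holds: if $\kappa^\dagger>0$ is a constant (possibly depending on the path $J$) with $\kappa_n\to\kappa^\dagger$ in $P^\star_J$-probability, and if $\pi$ is continuous and positive in a neighborhood of $\theta^\dagger$, then \[ d\bigl(\Pi_n,\,{\sf N}(\hat\theta_n,\,2\kappa^\dagger\theta^{\dagger2}n^{-1})\bigr)\to0\quad\text{in }P^\star_J\text{-probability as }n\to\infty. \] (b) If, for a $\sigma(J)$-measurable $\kappa^\dagger$ (up to null sets), the assumptions in (a) hold for $P^\star$-almost every path $J$, then the convergence in (a) also holds unconditionally, i.e. in $P^\star$-probability. -/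

import Mathlib

open MeasureTheory ProbabilityTheory Filter Topology
open scoped NNReal ENNReal

noncomputable section

namespace JumpDiffusion

/-- Real-valued paths on the time interval `[0, T]`, with the product (cylinder) σ-algebra. -/
abbrev Path (T : ℝ≥0) : Type := Set.Iic T → ℝ

/-- A path of a pure jump process of finite activity: there are finitely many jump times `s`, with
(finite) jump sizes `a s`, and the path moves only by accumulating these jumps. -/
def IsFiniteActivityPath {T : ℝ≥0} (j : Path T) : Prop :=
  ∃ (S : Finset (Set.Iic T)) (a : Set.Iic T → ℝ),
    ∀ t, j t = j ⟨0, Set.mem_Iic.mpr zero_le⟩ + ∑ s ∈ S with s ≤ t, a s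

/-- The jump `j(s) - j(s-)` of a path at time `s` (it is `0` at time `0`). -/
def jump {T : ℝ≥0} (j : Path T) (s : Set.Iic T) : ℝ := j s - Function.leftLim j s

/-- The quadratic variation `[J]` of a jump path on `[0, T]`: the sum of its squared jumps. -/
def jumpQV {T : ℝ≥0} (j : Path T) : ℝ := ∑ᶠ s, jump j s ^ 2

/-- The sampling time `t_k = k T / n`, for `k = 0, …, n`. -/
def gridTime (T : ℝ≥0) (n : ℕ) (k : Fin (n + 1)) : Set.Iic T :=
  ⟨(k : ℝ≥0) * T / n, by
    rcases Nat.eq_zero_or_pos n with hn | hn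
    · subst hn
      simp
    · have hn' : (0 : ℝ≥0) < n := by exact_mod_cast hn
      have hk : ((k : ℕ) : ℝ≥0) ≤ n := by exact_mod_cast Nat.lt_succ_iff.mp k.2
      rw [Set.mem_Iic, div_le_iff₀ hn', mul_comm T]
      exact mul_le_mul_left hk T⟩

/-- The process `X_t = β t + θ^{1/2} W_t + J_t`, `t ∈ [0, T]`. -/
def process {Ω : Type*} {T : ℝ≥0} (β θ : ℝ) (W : ℝ≥0 → Ω → ℝ) (J : Ω → Path T)
    (t : Set.Iic T) (ω : Ω) : ℝ :=
  β * ((t : ℝ≥0) : ℝ) + √θ * W t ω + J ω t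

/-- The observed differences `D_i = X_{t_i} - X_{t_{i-1}}`, `i = 1, …, n`. -/
def increments {Ω : Type*} {T : ℝ≥0} (β θ : ℝ) (W : ℝ≥0 → Ω → ℝ) (J : Ω → Path T)
    (n : ℕ) (ω : Ω) : Fin n → ℝ := fun i =>
  process β θ W J (gridTime T n i.succ) ω - process β θ W J (gridTime T n i.castSucc) ω

/-- The likelihood `L_n(θ) = θ^{-n/2} exp{-(2 Δ_n θ)⁻¹ ∑ D_i²}`, `Δ_n = T / n`, of the misspecified
model in which the differences are iid `N(0, θ Δ_n)`. -/
def likelihood (T : ℝ≥0) {n : ℕ} (D : Fin n → ℝ) (θ : ℝ) : ℝ :=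
  θ ^ (-(n : ℝ) / 2) * Real.exp (-(1 / (2 * ((T : ℝ) / n) * θ)) * ∑ i, D i ^ 2)

/-- The maximum likelihood estimator `T⁻¹ ∑ D_i²` in the misspecified model. -/
def mle (T : ℝ≥0) {n : ℕ} (D : Fin n → ℝ) : ℝ := (T : ℝ)⁻¹ * ∑ i, D i ^ 2

/-- The measure `L_n(θ)^{1/κ} π(θ) dθ` on `(0, ∞)`. -/
def unnormalizedPosterior (T : ℝ≥0) (π : ℝ → ℝ) {n : ℕ} (D : Fin n → ℝ) (κ : ℝ) : Measure ℝ :=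
  (volume.restrict (Set.Ioi 0)).withDensity
    fun θ => ENNReal.ofReal (likelihood T D θ ^ (1 / κ) * π θ)

/-- The tempered pseudo-posterior `Π_n(A) = ∫_A L_n^{1/κ} π dθ / ∫ L_n^{1/κ} π dθ`. -/
def pseudoPosterior (T : ℝ≥0) (π : ℝ → ℝ) {n : ℕ} (D : Fin n → ℝ) (κ : ℝ) : Measure ℝ :=
  (unnormalizedPosterior T π D κ Set.univ)⁻¹ • unnormalizedPosterior T π D κ

/-- The total variation distance `sup_A |μ(A) - ν(A)|`. -/
def tvDist (μ ν : Measure ℝ) : ℝ := ⨆ A : {A : Set ℝ // MeasurableSet A}, |μ.real A - ν.real A|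

/-- The total variation distance between the pseudo-posterior, computed from the differences `D`
with temperature `κ`, and the normal distribution `N(mle, 2 κ' θ'² / n)`. -/
def bvmDist (T : ℝ≥0) (π : ℝ → ℝ) {n : ℕ} (D : Fin n → ℝ) (κ κ' θ' : ℝ) : ℝ :=
  tvDist (pseudoPosterior T π D κ) (gaussianReal (mle T D) (2 * κ' * θ' ^ 2 / n).toNNReal)

/-- The pseudo-true value `θ† = θ* + T⁻¹ [J]`. -/
def pseudoTrue {T : ℝ≥0} (θ : ℝ) (j : Path T) : ℝ := θ + (T : ℝ)⁻¹ * jumpQV j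

/-- `P*_J`: the (regular) conditional distribution, given the jump path `J`, of the observed
differences `(D_1, …, D_n)` together with the temperature `κ_n`. -/
def condLaw {Ω : Type*} [MeasurableSpace Ω] (P : Measure Ω) [IsFiniteMeasure P] {T : ℝ≥0}
    (β θ : ℝ) (W : ℝ≥0 → Ω → ℝ) (J : Ω → Path T) (κ : ℕ → Ω → ℝ) (n : ℕ) :
    Kernel (Path T) ((Fin n → ℝ) × ℝ) :=
  condDistrib (fun ω => (increments β θ W J n ω, κ n ω)) J P

/-- `κ_n → κ†` in `P*_J`-probability, for the given jump path `j`. -/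
def TemperatureTendsto {Ω : Type*} [MeasurableSpace Ω] (P : Measure Ω) [IsFiniteMeasure P]
    {T : ℝ≥0} (β θ : ℝ) (W : ℝ≥0 → Ω → ℝ) (J : Ω → Path T) (κ : ℕ → Ω → ℝ)
    (j : Path T) (κ' : ℝ) : Prop :=
  ∀ ε > 0, Tendsto (fun n => condLaw P β θ W J κ n j {x | ε ≤ |x.2 - κ'|}) atTop (𝓝 0)

end JumpDiffusion

end

open JumpDiffusion

/-!
The likelihood depends on the data only through `n` and the estimator `θ̂ = mle`: for `θ > 0`,
`L_n(θ) ^ (1 / κ) = const * exp (-(n / (2 κ)) * deviance (θ / θ̂))`, where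
`deviance x = log x + 1 / x - 1` behaves like `(x - 1) ^ 2 / 2` near `1` and is bounded away from
`0` far from `1`. The theorem therefore splits into an analytic and a probabilistic part.

The analytic part is Laplace's method. With `s ^ 2 = 2 κ† θ† ^ 2 / n` and `θ = θ̂ + s u`, the exponent
tends to `-u ^ 2 / 2` and the prior to `π(θ†)`; the lower bound `min_one_sq_le_deviance` supplies a
Gaussian dominating function near `θ̂` and makes the mass away from `θ̂` exponentially small. The
resulting `L¹` convergence (`tendsto_integral_abs_tiltedPrior_sub_gaussian`) bounds the total
variation distance through `tvDist_normalize_le`. Hence the distance tends to `0` whenever `θ̂ → θ†`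
and `κ_n → κ†`, uniformly for `(θ†, κ†)` in compact sets (`exists_forall_bvmDist_lt`).

The probabilistic part is the consistency of `θ̂`. Given `J = j`, independence of `W` and `J` makes the
increments independent normal variables whose means have squares summing to `[j] + o(1)`, since for
a fine grid each cell holds at most one jump; Chebyshev's inequality gives `θ̂ → θ†`
(`tendsto_measure_mle_sub_pseudoTrue`). Unconditionally, dominated convergence transfers the
conditional statements to `P`, and tightness of the law of `(θ†, κ†)` reduces the claim to a compact
set of limits, so that no measurability of the total variation distance in the data is needed.
-/

namespace JumpDiffusion

/-! ### The deviance -/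

/-- The deviance `log x + 1 / x - 1` of a variance ratio `x > 0`, twice the Kullback–Leibler
divergence between centred normal laws with that variance ratio. It is `0` at `x = 1`, and
`L_n(θ) / L_n(θ̂) = exp (-(n / 2) * deviance (θ / θ̂))` for the estimator `θ̂ = mle`. -/
noncomputable def deviance (x : ℝ) : ℝ := Real.log x + x⁻¹ - 1

@[fun_prop]
lemma measurable_deviance : Measurable deviance := by
  unfold deviance; fun_prop

/-- A global lower bound on the deviance: quadratic near `1`, bounded away from `0` elsewhere. With
`s = √x`, it follows from `log s⁻¹ ≤ s⁻¹ - 1`, which says that `(s⁻¹ - 1) ^ 2 ≤ deviance x`. -/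
lemma min_one_sq_le_deviance {x : ℝ} (hx : 0 < x) : min 1 ((x - 1) ^ 2) / 16 ≤ deviance x := by
  set s := √x with hs
  have hs0 : 0 < s := Real.sqrt_pos.mpr hx
  have hxs : x = s ^ 2 := (Real.sq_sqrt hx.le).symm
  have h1 : (s⁻¹ - 1) ^ 2 ≤ deviance x := by
    have h := Real.log_le_sub_one_of_pos (inv_pos.mpr hs0)
    rw [Real.log_inv] at h
    rw [deviance, hxs, Real.log_pow]
    push_cast
    have : (s⁻¹ - 1) ^ 2 = (s ^ 2)⁻¹ - 2 * s⁻¹ + 1 := by rw [← inv_pow]; ring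
    linarith
  refine le_trans ?_ h1
  rcases le_total x 2 with h2 | h2
  · have h3 : s ≤ 3 / 2 := by nlinarith
    have h4 : (s⁻¹ - 1) ^ 2 = (1 - s) ^ 2 / s ^ 2 := by field_simp
    have h5 : min 1 ((x - 1) ^ 2) ≤ (x - 1) ^ 2 := min_le_right _ _
    have h6 : (x - 1) ^ 2 = (1 - s) ^ 2 * (1 + s) ^ 2 := by rw [hxs]; ring
    rw [h4, div_le_div_iff₀ (by norm_num) (by positivity)]
    have h7 : (1 + s) ^ 2 * s ^ 2 ≤ 16 := by
      have : (1 + s) * s ≤ 4 := by nlinarith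
      calc (1 + s) ^ 2 * s ^ 2 = ((1 + s) * s) ^ 2 := by ring
        _ ≤ 4 ^ 2 := by gcongr
        _ = 16 := by norm_num
    calc min 1 ((x - 1) ^ 2) * s ^ 2 ≤ (1 - s) ^ 2 * (1 + s) ^ 2 * s ^ 2 := by
          rw [← h6]; gcongr
      _ = (1 - s) ^ 2 * ((1 + s) ^ 2 * s ^ 2) := by ring
      _ ≤ (1 - s) ^ 2 * 16 := by gcongr
  · have h3 : (4 / 3 : ℝ) ≤ s := by
      rw [hs]; apply Real.le_sqrt_of_sq_le; linarith
    have h4 : s⁻¹ ≤ 3 / 4 := by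
      rw [inv_le_comm₀ hs0 (by norm_num)]; linarith
    have h5 : min 1 ((x - 1) ^ 2) ≤ 1 := min_le_left _ _
    nlinarith

lemma deviance_nonneg {x : ℝ} (hx : 0 < x) : 0 ≤ deviance x :=
  le_trans (by positivity) (min_one_sq_le_deviance hx)

lemma abs_deviance_sub_le {x : ℝ} (hx : |x| ≤ 1 / 2) :
    |deviance (1 + x) - x ^ 2 / 2| ≤ 4 * |x| ^ 3 := by
  have h1 := Real.abs_log_sub_add_sum_range_le (x := -x) (by rw [abs_neg]; linarith) 2
  simp only [Finset.sum_range_succ, Finset.sum_range_zero, abs_neg, sub_neg_eq_add] at h1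
  norm_num at h1
  have hx' := abs_le.mp hx
  have h1x : 0 < 1 + x := by linarith
  have h2 : |x| ^ 3 / (1 - |x|) ≤ 2 * |x| ^ 3 := by
    rw [div_le_iff₀ (by linarith)]
    nlinarith [pow_nonneg (abs_nonneg x) 3]
  have h3 : |x ^ 3 / (1 + x)| ≤ 2 * |x| ^ 3 := by
    rw [abs_div, abs_pow, abs_of_pos h1x, div_le_iff₀ h1x]
    nlinarith [pow_nonneg (abs_nonneg x) 3]
  have h4 : deviance (1 + x) - x ^ 2 / 2
      = (-x + x ^ 2 / 2 + Real.log (1 + x)) - x ^ 3 / (1 + x) := by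
    rw [deviance]; field_simp; ring
  rw [h4]
  calc _ ≤ |-x + x ^ 2 / 2 + Real.log (1 + x)| + |x ^ 3 / (1 + x)| := abs_sub _ _
    _ ≤ _ := by linarith

/-- The deviance is `x ^ 2 / 2` to second order at `1 + x`. -/
lemma tendsto_mul_deviance {ι : Type*} {l : Filter ι} {a x : ι → ℝ} {b : ℝ}
    (hx : Tendsto x l (𝓝 0)) (hax : Tendsto (fun i => a i * x i ^ 2) l (𝓝 b)) :
    Tendsto (fun i => a i * deviance (1 + x i)) l (𝓝 (b / 2)) := by
  have h0 : Tendsto (fun i => a i * (deviance (1 + x i) - x i ^ 2 / 2)) l (𝓝 0) := by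
    have hb : Tendsto (fun i => 4 * (|a i * x i ^ 2| * |x i|)) l (𝓝 0) := by
      simpa using (hax.abs.mul hx.abs).const_mul 4
    refine squeeze_zero_norm' ?_ hb
    have : ∀ᶠ i in l, |x i| ≤ 1 / 2 := by
      have := hx.abs
      rw [abs_zero] at this
      exact this.eventually_le_const (by norm_num)
    filter_upwards [this] with i hi
    rw [Real.norm_eq_abs, abs_mul]
    calc |a i| * |deviance (1 + x i) - x i ^ 2 / 2| ≤ |a i| * (4 * |x i| ^ 3) := by
          gcongr; exact abs_deviance_sub_le hi
      _ = _ := by rw [abs_mul, abs_pow]; ring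
  have := h0.add (hax.div_const 2)
  rw [zero_add] at this
  refine this.congr fun i => ?_
  ring

/-! ### Total variation of a normalized density -/

/-- Normalizing an unnormalized density `f` brings it within twice the `L¹` distance between `g` and
any multiple `c * f`. If `f` vanishes almost everywhere, the normalized measure is the zero measure
and the bound still holds. -/
lemma tvDist_normalize_le {f g : ℝ → ℝ} (hf0 : ∀ x, 0 ≤ f x) (hf : Integrable f)
    (hg0 : ∀ x, 0 ≤ g x) (hg : Integrable g) (hg1 : ∫ x, g x = 1) (c : ℝ) :
    tvDist (((volume.withDensity fun x => ENNReal.ofReal (f x)) Set.univ)⁻¹ •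
        volume.withDensity fun x => ENNReal.ofReal (f x))
      (volume.withDensity fun x => ENNReal.ofReal (g x)) ≤ 2 * ∫ x, |c * f x - g x| := by
  have hreal : ∀ (u : ℝ → ℝ), (∀ x, 0 ≤ u x) → Integrable u → ∀ A, MeasurableSet A →
      (volume.withDensity fun x => ENNReal.ofReal (u x)).real A = ∫ x in A, u x := by
    intro u hu0 hu A hA
    rw [Measure.real, withDensity_apply _ hA, ← ofReal_integral_eq_lintegral_ofReal hu.integrableOn
      (ae_of_all _ hu0), ENNReal.toReal_ofReal (integral_nonneg hu0)]
  have : Nonempty {A : Set ℝ // MeasurableSet A} := ⟨⟨∅, MeasurableSet.empty⟩⟩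
  refine ciSup_le fun A => ?_
  obtain ⟨A, hA⟩ := A
  have hdiff : Integrable fun x => |c * f x - g x| := ((hf.const_mul c).sub hg).abs
  have hset : ∀ B, MeasurableSet B →
      |c * (∫ x in B, f x) - ∫ x in B, g x| ≤ ∫ x, |c * f x - g x| := by
    intro B hB
    rw [← integral_const_mul, ← integral_sub (hf.const_mul c).integrableOn hg.integrableOn]
    exact (abs_integral_le_integral_abs).trans
      (setIntegral_le_integral hdiff (ae_of_all _ fun x => abs_nonneg _))
  have hU := hset _ MeasurableSet.univ
  have hAA := hset A hA
  simp only [Measure.restrict_univ] at hU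
  rw [hg1] at hU
  simp only [measureReal_ennreal_smul_apply, ENNReal.toReal_inv]
  rw [← Measure.real, hreal f hf0 hf A hA, hreal f hf0 hf _ MeasurableSet.univ, hreal g hg0 hg A hA,
    Measure.restrict_univ]
  set z := ∫ x, f x
  set a := ∫ x in A, f x
  set b := ∫ x in A, g x
  set η := ∫ x, |c * f x - g x|
  have ha0 : 0 ≤ a := integral_nonneg hf0
  have haz : a ≤ z := setIntegral_le_integral hf (ae_of_all _ hf0)
  have hη : 0 ≤ η := integral_nonneg fun x => abs_nonneg _
  -- `z = 0` makes the normalized measure vanish through `0⁻¹ = 0`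
  rcases (ha0.trans haz).eq_or_lt with hz | hz
  · have : a = 0 := le_antisymm (hz ▸ haz) ha0
    rw [this] at hAA ⊢
    simp only [mul_zero] at hAA ⊢
    linarith
  · have h1 : z⁻¹ * a - b = (c * a - b) - (c * z - 1) * (z⁻¹ * a) := by field_simp; ring
    have h2 : 0 ≤ z⁻¹ * a := by positivity
    have h3 : z⁻¹ * a ≤ 1 := by rw [inv_mul_le_iff₀ hz]; linarith
    rw [h1]
    calc _ ≤ |c * a - b| + |(c * z - 1) * (z⁻¹ * a)| := abs_sub _ _
      _ ≤ η + η * 1 := by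
        rw [abs_mul, abs_of_nonneg h2]; gcongr
      _ = 2 * η := by ring

/-! ### The Laplace approximation -/

section
variable {ι : Type*} {l : Filter ι}

/-- The density `exp (-(a * deviance (θ / h))) π(θ)` on `(0, ∞)`, extended by `0`. With
`a = n / (2 κ)` and `h = mle`, it is the unnormalized tempered posterior divided by the maximal
value of the tempered likelihood. -/
noncomputable def tiltedPrior (π : ℝ → ℝ) (a h : ℝ) : ℝ → ℝ :=
  (Set.Ioi 0).indicator fun t => Real.exp (-(a * deviance (t / h))) * π t

lemma tiltedPrior_nonneg {π : ℝ → ℝ} (hπ0 : ∀ t > 0, 0 ≤ π t) (a h t : ℝ) :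
    0 ≤ tiltedPrior π a h t :=
  Set.indicator_nonneg (fun t ht => mul_nonneg (Real.exp_nonneg _) (hπ0 t ht)) t

lemma tiltedPrior_le_indicator {π : ℝ → ℝ} (hπ0 : ∀ t > 0, 0 ≤ π t) {a h : ℝ} (ha : 0 ≤ a)
    (hh : 0 < h) (t : ℝ) : tiltedPrior π a h t ≤ (Set.Ioi 0).indicator π t := by
  refine Set.indicator_le_indicator' fun (ht : 0 < t) => ?_
  have : Real.exp (-(a * deviance (t / h))) ≤ 1 := by
    rw [Real.exp_le_one_iff, neg_nonpos]
    exact mul_nonneg ha (deviance_nonneg (by positivity))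
  exact mul_le_of_le_one_left (hπ0 t ht) this

lemma measurable_tiltedPrior {π : ℝ → ℝ} (hπm : Measurable π) (a h : ℝ) :
    Measurable (tiltedPrior π a h) := by
  unfold tiltedPrior
  exact Measurable.indicator (by fun_prop) measurableSet_Ioi

lemma integrable_indicator_prior {π : ℝ → ℝ} (hπm : Measurable π) (hπ0 : ∀ t > 0, 0 ≤ π t)
    (hπ1 : ∫⁻ t in Set.Ioi 0, ENNReal.ofReal (π t) = 1) :
    Integrable ((Set.Ioi 0).indicator π) := by
  rw [integrable_indicator_iff measurableSet_Ioi]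
  refine ⟨hπm.aestronglyMeasurable, ?_⟩
  rw [hasFiniteIntegral_iff_ofReal, hπ1]
  · simp
  · exact (ae_restrict_mem measurableSet_Ioi).mono fun t ht => hπ0 t ht

lemma integrable_tiltedPrior {π : ℝ → ℝ} (hπm : Measurable π) (hπ0 : ∀ t > 0, 0 ≤ π t)
    (hπ1 : ∫⁻ t in Set.Ioi 0, ENNReal.ofReal (π t) = 1) {a h : ℝ} (ha : 0 ≤ a) (hh : 0 < h) :
    Integrable (tiltedPrior π a h) := by
  refine (integrable_indicator_prior hπm hπ0 hπ1).mono'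
    (measurable_tiltedPrior hπm a h).aestronglyMeasurable (ae_of_all _ fun t => ?_)
  rw [Real.norm_of_nonneg (tiltedPrior_nonneg hπ0 a h t)]
  exact tiltedPrior_le_indicator hπ0 ha hh t

/-- Away from the peak `h`, the tilted prior has mass exponentially small in `a`, hence negligible
against the peak width `s`, which is of order `a ^ (-1 / 2)`. -/
lemma tendsto_integral_tiltedPrior_tail {π : ℝ → ℝ} (hπm : Measurable π) (hπ0 : ∀ t > 0, 0 ≤ π t)
    (hπ1 : ∫⁻ t in Set.Ioi 0, ENNReal.ofReal (π t) = 1)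
    {a h s : ι → ℝ} {h₀ : ℝ} (hh₀ : 0 < h₀) (ha : Tendsto a l atTop)
    (hh : Tendsto h l (𝓝 h₀)) (hs : ∀ᶠ i in l, 0 < s i)
    (has : Tendsto (fun i => a i * s i ^ 2) l (𝓝 (h₀ ^ 2))) {r : ℝ} (hr : 0 < r) :
    Tendsto (fun i => (s i)⁻¹ * ∫ t in {t | r < |t - h i|}, tiltedPrior π (a i) (h i) t)
      l (𝓝 0) := by
  set η : ℝ := min 1 ((r / (2 * h₀)) ^ 2) / 16 with hηdef
  have hη : 0 < η := by positivity
  have hπi := integrable_indicator_prior hπm hπ0 hπ1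
  set K : ℝ := ∫ t, (Set.Ioi 0).indicator π t
  -- the normalisation `s⁻¹` grows like `√a`, and `√a * exp (-η * a)` vanishes
  have hlim : Tendsto (fun i => (√(a i) * Real.exp (-(η * a i))) * (√(a i * s i ^ 2))⁻¹ * K)
      l (𝓝 0) := by
    have h1 : Tendsto (fun x : ℝ => √x * Real.exp (-(η * x))) atTop (𝓝 0) := by
      refine (tendsto_rpow_mul_exp_neg_mul_atTop_nhds_zero (1 / 2) η hη).congr fun x => ?_
      rw [Real.sqrt_eq_rpow, neg_mul]
    have h2 : Tendsto (fun i => (√(a i * s i ^ 2))⁻¹) l (𝓝 (√(h₀ ^ 2))⁻¹) :=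
      ((Real.continuous_sqrt.tendsto _).comp has).inv₀ (by positivity)
    simpa using ((h1.comp ha).mul h2).mul_const K
  refine squeeze_zero' ?_ ?_ hlim
  · filter_upwards [hs] with i hi
    exact mul_nonneg (inv_nonneg.mpr hi.le)
      (integral_nonneg fun t => tiltedPrior_nonneg hπ0 _ _ t)
  · filter_upwards [hs, ha.eventually_gt_atTop 0, hh.eventually_lt_const (show h₀ < 2 * h₀ by linarith),
      hh.eventually_const_lt hh₀] with i hsi hai hhi hhi0
    have h1 : √(a i) * Real.exp (-(η * a i)) * (√(a i * s i ^ 2))⁻¹ * K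
        = (s i)⁻¹ * (Real.exp (-(η * a i)) * K) := by
      have : 0 < √(a i) := Real.sqrt_pos.mpr hai
      rw [Real.sqrt_mul hai.le, Real.sqrt_sq hsi.le]
      field_simp
    rw [h1]
    gcongr
    rw [← integral_const_mul]
    have hbound : ∀ t ∈ {t | r < |t - h i|}, tiltedPrior π (a i) (h i) t
        ≤ Real.exp (-(η * a i)) * (Set.Ioi 0).indicator π t := by
      intro t ht
      rcases le_or_gt t 0 with ht0 | ht0
      · simp [tiltedPrior, ht0]
      rw [tiltedPrior, Set.indicator_of_mem (show t ∈ Set.Ioi 0 from ht0),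
        Set.indicator_of_mem (show t ∈ Set.Ioi 0 from ht0)]
      have hπt := hπ0 t ht0
      rw [mul_comm η]
      gcongr
      refine le_trans ?_ (min_one_sq_le_deviance (by positivity))
      have h2 : |t / h i - 1| = |t - h i| / h i := by
        rw [← abs_of_pos hhi0, ← abs_div, abs_of_pos hhi0, sub_div, div_self hhi0.ne']
      have ht' : r < |t - h i| := ht
      rw [hηdef, ← sq_abs (t / h i - 1), h2]
      gcongr
    calc _ ≤ ∫ t in {t | r < |t - h i|}, Real.exp (-(η * a i)) * (Set.Ioi 0).indicator π t := by
          refine setIntegral_mono_on (integrable_tiltedPrior hπm hπ0 hπ1 hai.le hhi0).integrableOn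
            (hπi.const_mul _).integrableOn ?_ hbound
          exact measurableSet_lt measurable_const (by fun_prop)
      _ ≤ _ := setIntegral_le_integral (hπi.const_mul _) (ae_of_all _ fun t =>
          mul_nonneg (Real.exp_nonneg _) (Set.indicator_nonneg hπ0 t))

lemma tendsto_scale {a s : ι → ℝ} {b : ℝ} (ha : Tendsto a l atTop)
    (has : Tendsto (fun i => a i * s i ^ 2) l (𝓝 b)) : Tendsto s l (𝓝 0) := by
  have h1 : Tendsto (fun i => s i ^ 2) l (𝓝 0) := by
    have := (has.mul ha.inv_tendsto_atTop)
    rw [mul_zero] at this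
    refine this.congr' ?_
    filter_upwards [ha.eventually_gt_atTop 0] with i hi
    simp only [Pi.inv_apply]
    field_simp
  have h2 := (Real.continuous_sqrt.tendsto _).comp h1
  rw [Real.sqrt_zero] at h2
  exact tendsto_zero_iff_abs_tendsto_zero _ |>.mpr (h2.congr fun i => Real.sqrt_sq_eq_abs _)

/-- Near the peak, the tilted prior rescaled by `t = h + s * u` converges in `L¹` to the standard
Gaussian profile. -/
lemma tendsto_integral_tiltedPrior_center [l.IsCountablyGenerated] {π : ℝ → ℝ} (hπm : Measurable π) (hπ0 : ∀ t > 0, 0 ≤ π t)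
    {a h s : ι → ℝ} {h₀ : ℝ} (hh₀ : 0 < h₀) (ha : Tendsto a l atTop)
    (hh : Tendsto h l (𝓝 h₀))
    (has : Tendsto (fun i => a i * s i ^ 2) l (𝓝 (h₀ ^ 2)))
    (hπc : ContinuousAt π h₀) (hπp : 0 < π h₀)
    {r M : ℝ} (hr : 0 < r) (hrh : 2 * r ≤ h₀) (hM : ∀ t, |t - h₀| < 2 * r → π t ≤ M) :
    Tendsto (fun i => ∫ u, |{t | |t - h i| ≤ r}.indicator
        (fun t => (π h₀)⁻¹ * tiltedPrior π (a i) (h i) t) (h i + s i * u)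
          - Real.exp (-(u ^ 2 / 2))|) l (𝓝 0) := by
  have hs0 := tendsto_scale ha has
  have hM0 : 0 ≤ M := hπp.le.trans (hM h₀ (by simp [hr]))
  have hr' : ∀ᶠ i in l, |h i - h₀| < r := by
    have := hh.eventually (Metric.ball_mem_nhds h₀ hr)
    simpa [Real.dist_eq] using this
  have hcoef : Tendsto (fun i => a i * (s i / h i) ^ 2) l (𝓝 1) := by
    have := has.div (hh.pow 2) (by positivity)
    rw [div_self (by positivity)] at this
    refine this.congr fun i => ?_
    simp only [Pi.div_apply, div_pow, mul_div_assoc]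
  rw [show (0 : ℝ) = ∫ u : ℝ, (0 : ℝ) by simp]
  refine tendsto_integral_filter_of_dominated_convergence
    (fun u => (π h₀)⁻¹ * M * Real.exp (-(1 / 32) * u ^ 2) + Real.exp (-(1 / 2) * u ^ 2)) ?_ ?_ ?_ ?_
  · refine Eventually.of_forall fun i => Measurable.aestronglyMeasurable ?_
    have h1 : Measurable ({t | |t - h i| ≤ r}.indicator
        (fun t => (π h₀)⁻¹ * tiltedPrior π (a i) (h i) t)) :=
      ((measurable_tiltedPrior hπm _ _).const_mul _).indicator
        (measurableSet_le (by fun_prop) measurable_const)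
    have h2 : Measurable fun u => h i + s i * u := by fun_prop
    exact measurable_norm.comp ((h1.comp h2).sub (by fun_prop : Measurable fun u : ℝ => Real.exp (-(u ^ 2 / 2))))
  · filter_upwards [hr', ha.eventually_gt_atTop 0,
      hcoef.eventually_const_lt (show (1 / 2 : ℝ) < 1 by norm_num)] with i hi hai hci
    refine ae_of_all _ fun u => ?_
    have hi' := abs_lt.mp hi
    have hhi : r ≤ h i := by linarith
    have hhi0 : 0 < h i := hr.trans_le hhi
    rw [Real.norm_eq_abs, abs_abs]
    refine (abs_sub _ _).trans ?_
    rw [abs_of_nonneg (Real.exp_nonneg _)]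
    refine add_le_add ?_ (le_of_eq (by congr 1; ring))
    by_cases hu : |h i + s i * u - h i| ≤ r
    swap
    · rw [Set.indicator_of_notMem (by exact hu), abs_zero]; positivity
    rw [Set.indicator_of_mem (by exact hu)]
    rw [add_sub_cancel_left] at hu
    have hu' := abs_le.mp hu
    have htpos : 0 ≤ h i + s i * u := by linarith
    rcases htpos.eq_or_lt with h0 | h0
    · rw [← h0]; simp [tiltedPrior]; positivity
    rw [tiltedPrior, Set.indicator_of_mem (show h i + s i * u ∈ Set.Ioi 0 from h0)]
    have hπle : π (h i + s i * u) ≤ M := by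
      apply hM
      rw [show h i + s i * u - h₀ = (h i - h₀) + s i * u by ring]
      exact (abs_add_le _ _).trans_lt (by linarith)
    have hπge := hπ0 _ h0
    rw [abs_of_nonneg (by positivity), mul_assoc]
    gcongr ?_ * ?_
    rw [mul_comm M]
    gcongr
    rw [neg_mul, neg_le_neg_iff]
    have h1 : (s i / h i * u) ^ 2 ≤ 1 := by
      rw [sq_le_one_iff_abs_le_one, div_mul_eq_mul_div, abs_div, abs_of_pos hhi0, div_le_one hhi0]
      linarith
    have h2 := min_one_sq_le_deviance (x := (h i + s i * u) / h i) (by positivity)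
    rw [show (h i + s i * u) / h i - 1 = s i / h i * u by field_simp; ring, min_eq_right h1] at h2
    calc 1 / 32 * u ^ 2 ≤ (a i * (s i / h i) ^ 2) * u ^ 2 / 16 := by nlinarith [sq_nonneg u]
      _ = a i * ((s i / h i * u) ^ 2 / 16) := by ring
      _ ≤ _ := by gcongr
  · exact ((integrable_exp_neg_mul_sq (by norm_num)).const_mul _).add
      (integrable_exp_neg_mul_sq (by norm_num))
  · refine ae_of_all _ fun u => ?_
    have hx : Tendsto (fun i => s i / h i * u) l (𝓝 0) := by
      simpa using (hs0.div hh hh₀.ne').mul_const u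
    -- the exponent at the rescaled point is `a * deviance (1 + x)` with `a * x ^ 2 → u ^ 2`
    have hdev := tendsto_mul_deviance (a := a) (b := u ^ 2) hx (by
      have := hcoef.mul_const (u ^ 2)
      rw [one_mul] at this
      exact this.congr fun i => by ring)
    have ht : Tendsto (fun i => h i + s i * u) l (𝓝 h₀) := by
      simpa using hh.add (hs0.mul_const u)
    have hmain : Tendsto (fun i => (π h₀)⁻¹ * (Real.exp (-(a i * deviance (1 + s i / h i * u)))
        * π (h i + s i * u)) - Real.exp (-(u ^ 2 / 2))) l (𝓝 0) := by
      have h1 := (Real.continuous_exp.tendsto _).comp hdev.neg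
      have h2 := hπc.tendsto.comp ht
      have h3 := ((h1.mul h2).const_mul (π h₀)⁻¹).sub_const (Real.exp (-(u ^ 2 / 2)))
      rw [mul_left_comm, inv_mul_cancel₀ hπp.ne', mul_one, sub_self] at h3
      exact h3
    have hmain' := hmain.abs
    rw [abs_zero] at hmain'
    refine hmain'.congr' ?_
    have hsu : ∀ᶠ i in l, |s i * u| < r := by
      have := (hs0.mul_const u).abs
      rw [zero_mul, abs_zero] at this
      exact this.eventually_lt_const hr
    filter_upwards [hr', hsu, ht.eventually_const_lt hh₀, hh.eventually_const_lt hh₀]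
      with i hi hsi hti hhi
    rw [Set.indicator_of_mem (by simpa using hsi.le), tiltedPrior,
      Set.indicator_of_mem (show h i + s i * u ∈ Set.Ioi 0 from hti)]
    congr 7
    field_simp
end

/-- **Laplace approximation** in `L¹`: the tilted prior, scaled by the asymptotic normalization
`√(2π) s π(h₀)`, is asymptotically the normal density with mean `h` and variance `s ^ 2`. -/
lemma tendsto_integral_abs_tiltedPrior_sub_gaussian {ι : Type*} {l : Filter ι}
    [l.IsCountablyGenerated] {π : ℝ → ℝ} (hπm : Measurable π) (hπ0 : ∀ t > 0, 0 ≤ π t)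
    (hπ1 : ∫⁻ t in Set.Ioi 0, ENNReal.ofReal (π t) = 1)
    {a h s : ι → ℝ} {h₀ : ℝ} (hh₀ : 0 < h₀) (ha : Tendsto a l atTop)
    (hh : Tendsto h l (𝓝 h₀)) (hs : ∀ᶠ i in l, 0 < s i)
    (has : Tendsto (fun i => a i * s i ^ 2) l (𝓝 (h₀ ^ 2)))
    (hπc : ContinuousAt π h₀) (hπp : 0 < π h₀) :
    Tendsto (fun i => ∫ t, |(√(2 * Real.pi) * s i * π h₀)⁻¹ * tiltedPrior π (a i) (h i) t
      - gaussianPDFReal (h i) (s i ^ 2).toNNReal t|) l (𝓝 0) := by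
  obtain ⟨ρ, hρ, hM⟩ : ∃ ρ > 0, ∀ t, |t - h₀| < ρ → π t ≤ π h₀ + 1 := by
    have := hπc.eventually (eventually_le_nhds (show π h₀ < π h₀ + 1 by linarith))
    obtain ⟨ρ, hρ, h⟩ := Metric.eventually_nhds_iff.mp this
    exact ⟨ρ, hρ, fun t ht => h (by rwa [Real.dist_eq])⟩
  set r := min (ρ / 2) (h₀ / 2) with hrdef
  have hr : 0 < r := by positivity
  have hr1 : 2 * r ≤ ρ := by have := min_le_left (ρ / 2) (h₀ / 2); linarith
  have hr2 : 2 * r ≤ h₀ := by have := min_le_right (ρ / 2) (h₀ / 2); linarith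
  have hcen := tendsto_integral_tiltedPrior_center hπm hπ0 hh₀ ha hh has hπc hπp hr hr2
    (fun t ht => hM t (ht.trans_le hr1))
  have htail := tendsto_integral_tiltedPrior_tail hπm hπ0 hπ1 hh₀ ha hh hs has hr
  have hlim := (hcen.const_mul (√(2 * Real.pi))⁻¹).add
    (htail.const_mul (√(2 * Real.pi) * π h₀)⁻¹)
  simp only [mul_zero, add_zero] at hlim
  refine squeeze_zero' (Eventually.of_forall fun i => integral_nonneg fun t => abs_nonneg _) ?_ hlim
  filter_upwards [hs, ha.eventually_ge_atTop 0, hh.eventually_const_lt hh₀] with i hsi hai hhi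
  set f := tiltedPrior π (a i) (h i)
  set g := gaussianPDFReal (h i) (s i ^ 2).toNNReal
  set c := (√(2 * Real.pi) * s i * π h₀)⁻¹ with hc
  have hc0 : 0 ≤ c := by positivity
  set C := {t | |t - h i| ≤ r}
  have hC : MeasurableSet C := measurableSet_le (by fun_prop) measurable_const
  have hf0 : ∀ t, 0 ≤ f t := tiltedPrior_nonneg hπ0 _ _
  have hf : Integrable f := integrable_tiltedPrior hπm hπ0 hπ1 hai hhi
  have hg : Integrable g := integrable_gaussianPDFReal _ _
  have h1 : ∫ t, |c * f t - g t| ≤ (∫ t, |C.indicator (fun t => c * f t) t - g t|)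
      + c * ∫ t in Cᶜ, f t := by
    rw [← integral_const_mul, ← integral_indicator hC.compl, ← integral_add]
    · refine integral_mono ((hf.const_mul c).sub hg).abs
        ((((hf.const_mul c).indicator hC).sub hg).abs.add ((hf.const_mul c).indicator hC.compl))
        fun t => ?_
      by_cases ht : t ∈ C
      · simp [ht]
      · have : 0 ≤ c * f t := mul_nonneg hc0 (hf0 t)
        simp only [Set.indicator_of_notMem ht, Set.indicator_of_mem (Set.mem_compl ht)]
        calc |c * f t - g t| = |(0 - g t) + c * f t| := by congr 1; ring
          _ ≤ |0 - g t| + |c * f t| := abs_add_le _ _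
          _ = _ := by rw [abs_of_nonneg this]
    · exact (((hf.const_mul c).indicator hC).sub hg).abs
    · exact (hf.const_mul c).indicator hC.compl
  have h2 : ∫ t, |C.indicator (fun t => c * f t) t - g t| = (√(2 * Real.pi))⁻¹ *
      ∫ u, |C.indicator (fun t => (π h₀)⁻¹ * f t) (h i + s i * u) - Real.exp (-(u ^ 2 / 2))| := by
    -- substitute `t = h i + s i * u`
    set G : ℝ → ℝ := fun t => |C.indicator (fun t => c * f t) t - g t|
    have h3 : ∫ t, G t = s i * ∫ u, G (h i + s i * u) := by
      rw [Measure.integral_comp_mul_left (fun u => G (h i + u)), integral_add_left_eq_self G,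
        abs_of_pos (inv_pos.mpr hsi), smul_eq_mul, mul_inv_cancel_left₀ hsi.ne']
    rw [h3, ← integral_const_mul, ← integral_const_mul]
    refine integral_congr_ae (ae_of_all _ fun u => ?_)
    have hgu : g (h i + s i * u) = (√(2 * Real.pi) * s i)⁻¹ * Real.exp (-(u ^ 2 / 2)) := by
      simp only [g, gaussianPDFReal, Real.coe_toNNReal _ (sq_nonneg (s i))]
      rw [Real.sqrt_mul (by positivity), Real.sqrt_sq hsi.le]
      congr 2
      field_simp
      ring
    have hfu : C.indicator (fun t => c * f t) (h i + s i * u) = (√(2 * Real.pi) * s i)⁻¹ *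
        C.indicator (fun t => (π h₀)⁻¹ * f t) (h i + s i * u) := by
      by_cases hu : h i + s i * u ∈ C
      · simp only [Set.indicator_of_mem hu, hc, mul_inv]; ring
      · simp only [Set.indicator_of_notMem hu, mul_zero]
    simp only [G]
    rw [hgu, hfu, ← mul_sub, abs_mul, abs_of_nonneg (by positivity)]
    field_simp
  have h4 : Cᶜ = {t | r < |t - h i|} := by ext t; simp [C]
  rw [h2, h4] at h1
  refine h1.trans (le_of_eq ?_)
  rw [hc]
  congr 1
  field_simp

/-! ### The tempered posterior as a tilted prior -/

lemma likelihood_rpow {T : ℝ≥0} (hT : 0 < T) {n : ℕ} (hn : n ≠ 0) (D : Fin n → ℝ)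
    (hD : 0 < mle T D) {κ : ℝ} {t : ℝ} (ht : 0 < t) :
    likelihood T D t ^ (1 / κ) = Real.exp (-(n / (2 * κ) * (Real.log (mle T D) + 1))) *
      Real.exp (-(n / (2 * κ) * deviance (t / mle T D))) := by
  have hT' : (0 : ℝ) < T := hT
  have hsum : ∑ i, D i ^ 2 = T * mle T D := by rw [mle]; field_simp
  have hn' : (n : ℝ) ≠ 0 := by exact_mod_cast hn
  rw [likelihood, hsum, Real.rpow_def_of_pos ht, ← Real.exp_add, ← Real.exp_mul, ← Real.exp_add,
    deviance, Real.log_div ht.ne' hD.ne']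
  congr 1
  field_simp
  ring

/-- The total variation distance of the theorem in terms of the tilted prior; `c` is any candidate
for the normalizing constant. -/
lemma bvmDist_le {T : ℝ≥0} (hT : 0 < T) {π : ℝ → ℝ} (hπm : Measurable π) (hπ0 : ∀ t > 0, 0 ≤ π t)
    (hπ1 : ∫⁻ t in Set.Ioi 0, ENNReal.ofReal (π t) = 1) {n : ℕ} (hn : n ≠ 0) (D : Fin n → ℝ)
    (hD : 0 < mle T D) {κ κ' θ' : ℝ} (hκ : 0 < κ) (hκ' : 0 < κ') (hθ' : 0 < θ') (c : ℝ) :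
    bvmDist T π D κ κ' θ' ≤ 2 * ∫ t, |c * tiltedPrior π (n / (2 * κ)) (mle T D) t
      - gaussianPDFReal (mle T D) (2 * κ' * θ' ^ 2 / n).toNNReal t| := by
  set C := Real.exp (-(n / (2 * κ) * (Real.log (mle T D) + 1))) with hC
  have hCpos : 0 < C := Real.exp_pos _
  set m := mle T D
  have hn' : (0 : ℝ) < n := by positivity
  have hv : (2 * κ' * θ' ^ 2 / n).toNNReal ≠ 0 := by
    rw [Ne, Real.toNNReal_eq_zero, not_le]; positivity
  have hU : unnormalizedPosterior T π D κ = volume.withDensity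
      fun t => ENNReal.ofReal (C * tiltedPrior π (n / (2 * κ)) m t) := by
    rw [unnormalizedPosterior, ← withDensity_indicator measurableSet_Ioi]
    congr 1
    ext t
    by_cases ht : t ∈ Set.Ioi (0 : ℝ)
    · rw [Set.indicator_of_mem ht, likelihood_rpow hT hn D hD ht, tiltedPrior,
        Set.indicator_of_mem ht, mul_assoc]
    · rw [Set.indicator_of_notMem ht, tiltedPrior, Set.indicator_of_notMem ht]; simp
  have hint : Integrable (tiltedPrior π (n / (2 * κ)) m) :=
    integrable_tiltedPrior hπm hπ0 hπ1 (by positivity) hD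
  have key := tvDist_normalize_le (f := fun t => C * tiltedPrior π (n / (2 * κ)) m t)
    (g := gaussianPDFReal m (2 * κ' * θ' ^ 2 / n).toNNReal)
    (fun t => mul_nonneg hCpos.le (tiltedPrior_nonneg hπ0 _ _ t)) (hint.const_mul C)
    (gaussianPDFReal_nonneg _ _) (integrable_gaussianPDFReal _ _)
    (integral_gaussianPDFReal_eq_one _ hv) (c * C⁻¹)
  rw [bvmDist, pseudoPosterior, hU, gaussianReal_of_var_ne_zero _ hv]
  refine key.trans (le_of_eq ?_)
  congr 2
  ext t
  field_simp

/-- The deterministic Bernstein–von Mises limit: only the convergence of the estimator and of the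
temperature matters. It is stated along a filter so that the parameters of the limiting normal law
may vary as well. -/
lemma tendsto_bvmDist {ι : Type*} {l : Filter ι} [l.IsCountablyGenerated]
    {T : ℝ≥0} (hT : 0 < T) {π : ℝ → ℝ} (hπm : Measurable π)
    (hπ0 : ∀ t > 0, 0 ≤ π t) (hπ1 : ∫⁻ t in Set.Ioi 0, ENNReal.ofReal (π t) = 1)
    {n : ι → ℕ} {D : ∀ i, Fin (n i) → ℝ} {κ κ' θ' : ι → ℝ} {h₀ k₀ : ℝ} (hh₀ : 0 < h₀) (hk₀ : 0 < k₀)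
    (hπc : ContinuousAt π h₀) (hπp : 0 < π h₀)
    (hn : Tendsto n l atTop) (hD : Tendsto (fun i => mle T (D i)) l (𝓝 h₀))
    (hκ : Tendsto κ l (𝓝 k₀)) (hκ' : Tendsto κ' l (𝓝 k₀)) (hθ' : Tendsto θ' l (𝓝 h₀)) :
    Tendsto (fun i => bvmDist T π (D i) (κ i) (κ' i) (θ' i)) l (𝓝 0) := by
  have hnR : Tendsto (fun i => (n i : ℝ)) l atTop := tendsto_natCast_atTop_atTop.comp hn
  have hpos : ∀ᶠ i in l, n i ≠ 0 ∧ 0 < mle T (D i) ∧ 0 < κ i ∧ 0 < κ' i ∧ 0 < θ' i := by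
    filter_upwards [hn.eventually_ne_atTop 0, hD.eventually_const_lt hh₀,
      hκ.eventually_const_lt hk₀, hκ'.eventually_const_lt hk₀, hθ'.eventually_const_lt hh₀]
      with i h1 h2 h3 h4 h5 using ⟨h1, h2, h3, h4, h5⟩
  have ha : Tendsto (fun i => n i / (2 * κ i)) l atTop :=
    hnR.atTop_mul_pos (by positivity) ((hκ.const_mul 2).inv₀ (by positivity))
  have hs : ∀ᶠ i in l, 0 < √(2 * κ' i * θ' i ^ 2 / n i) := by
    filter_upwards [hpos] with i ⟨h1, _, _, h4, h5⟩
    have : (0 : ℝ) < n i := by positivity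
    positivity
  have has : Tendsto (fun i => n i / (2 * κ i) * √(2 * κ' i * θ' i ^ 2 / n i) ^ 2) l
      (𝓝 (h₀ ^ 2)) := by
    have h1 := ((hκ'.div hκ hk₀.ne').mul (hθ'.pow 2))
    rw [div_self hk₀.ne', one_mul] at h1
    refine h1.congr' ?_
    filter_upwards [hpos] with i ⟨h1, _, h3, h4, h5⟩
    have : (0 : ℝ) < n i := by positivity
    rw [Real.sq_sqrt (by positivity)]
    simp only [Pi.div_apply]
    field_simp
  have hlim := (tendsto_integral_abs_tiltedPrior_sub_gaussian hπm hπ0 hπ1 hh₀ ha hD hs has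
    hπc hπp).const_mul 2
  rw [mul_zero] at hlim
  refine squeeze_zero' (Eventually.of_forall fun i => ?_) ?_ hlim
  · exact Real.iSup_nonneg fun A => abs_nonneg _
  · filter_upwards [hpos] with i ⟨h1, h2, h3, h4, h5⟩
    have h6 := bvmDist_le hT hπm hπ0 hπ1 h1 (D i) h2 h3 h4 h5
      (√(2 * Real.pi) * √(2 * κ' i * θ' i ^ 2 / n i) * π h₀)⁻¹
    rwa [Real.sq_sqrt (by positivity)]

/-- The deterministic limit is uniform over compact sets of pairs `(θ†, κ†)`. For a random limit this
allows `δ` to be chosen independently of `ω`, so that the possibly nonmeasurable event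
`ε ≤ bvmDist …` is contained in events about the estimator and the temperature alone. -/
lemma exists_forall_bvmDist_lt {T : ℝ≥0} (hT : 0 < T) {π : ℝ → ℝ} (hπm : Measurable π)
    (hπ0 : ∀ t > 0, 0 ≤ π t) (hπ1 : ∫⁻ t in Set.Ioi 0, ENNReal.ofReal (π t) = 1)
    {K : Set (ℝ × ℝ)} (hK : IsCompact K)
    (hKπ : ∀ p ∈ K, 0 < p.1 ∧ 0 < p.2 ∧ ContinuousAt π p.1 ∧ 0 < π p.1) {ε : ℝ} (hε : 0 < ε) :
    ∃ δ > 0, ∃ N : ℕ, ∀ p ∈ K, ∀ n ≥ N, ∀ (D : Fin n → ℝ) (κ : ℝ), |mle T D - p.1| < δ →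
      |κ - p.2| < δ → bvmDist T π D κ p.2 p.1 < ε := by
  refine hK.induction_on (p := fun K => ∃ δ > 0, ∃ N : ℕ, ∀ p ∈ K, ∀ n ≥ N,
    ∀ (D : Fin n → ℝ) (κ : ℝ), |mle T D - p.1| < δ → |κ - p.2| < δ → bvmDist T π D κ p.2 p.1 < ε)
    ?_ ?_ ?_ ?_
  · exact ⟨1, one_pos, 0, by simp⟩
  · rintro s t hst ⟨δ, hδ, N, h⟩
    exact ⟨δ, hδ, N, fun p hp => h p (hst hp)⟩
  · rintro s t ⟨δ₁, hδ₁, N₁, h₁⟩ ⟨δ₂, hδ₂, N₂, h₂⟩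
    refine ⟨min δ₁ δ₂, lt_min hδ₁ hδ₂, max N₁ N₂, ?_⟩
    rintro p (hp | hp) n hn D κ hD hκ
    · exact h₁ p hp n (le_of_max_le_left hn) D κ (hD.trans_le (min_le_left _ _))
        (hκ.trans_le (min_le_left _ _))
    · exact h₂ p hp n (le_of_max_le_right hn) D κ (hD.trans_le (min_le_right _ _))
        (hκ.trans_le (min_le_right _ _))
  · rintro ⟨h₀, k₀⟩ hp
    obtain ⟨hh₀, hk₀, hπc, hπp⟩ := hKπ _ hp
    -- index by all data at once, with the coarsest filter making all five quantities converge
    let φ : (Σ n : ℕ, (Fin n → ℝ) × ℝ × ℝ × ℝ) → ℕ × ℝ × ℝ × ℝ × ℝ :=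
      fun x => (x.1, mle T x.2.1, x.2.2)
    let L := (atTop : Filter ℕ) ×ˢ (𝓝 h₀ ×ˢ (𝓝 k₀ ×ˢ (𝓝 h₀ ×ˢ 𝓝 k₀)))
    have hL : Tendsto φ (comap φ L) L := tendsto_comap
    have h2 : Tendsto (fun x => (φ x).2) (comap φ L) _ := tendsto_snd.comp hL
    have h3 : Tendsto (fun x => (φ x).2.2) (comap φ L) _ := tendsto_snd.comp h2
    have h4 : Tendsto (fun x => (φ x).2.2.2) (comap φ L) _ := tendsto_snd.comp h3
    have e1 : Tendsto (fun x => (φ x).1) (comap φ L) atTop := tendsto_fst.comp hL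
    have e2 : Tendsto (fun x => (φ x).2.1) (comap φ L) (𝓝 h₀) := tendsto_fst.comp h2
    have e3 : Tendsto (fun x => (φ x).2.2.1) (comap φ L) (𝓝 k₀) := tendsto_fst.comp h3
    have e4 : Tendsto (fun x => (φ x).2.2.2.1) (comap φ L) (𝓝 h₀) := tendsto_fst.comp h4
    have e5 : Tendsto (fun x => (φ x).2.2.2.2) (comap φ L) (𝓝 k₀) := tendsto_snd.comp h4
    have hlim := tendsto_bvmDist (l := comap φ L) hT hπm hπ0 hπ1 (n := fun x => x.1)
      (D := fun x => x.2.1) (κ := fun x => x.2.2.1) (θ' := fun x => x.2.2.2.1)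
      (κ' := fun x => x.2.2.2.2) hh₀ hk₀ hπc hπp e1 e2 e3 e5 e4
    have hev := hlim.eventually_lt_const hε
    rw [eventually_comap] at hev
    have hbasis := (atTop_basis (α := ℕ)).prod (Metric.nhds_basis_ball (x := h₀) |>.prod
      (Metric.nhds_basis_ball (x := k₀) |>.prod (Metric.nhds_basis_ball (x := h₀) |>.prod
      (Metric.nhds_basis_ball (x := k₀)))))
    obtain ⟨⟨N, r₁, r₂, r₃, r₄⟩, ⟨-, hr₁, hr₂, hr₃, hr₄⟩, hsub⟩ := hbasis.eventually_iff.mp hev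
    simp only at hr₁ hr₂ hr₃ hr₄ hsub
    set δ := min (min r₁ r₂) (min r₃ r₄) / 2 with hδ
    have hδ0 : 0 < δ := by positivity
    have hδ1 : 2 * δ ≤ r₁ := by rw [hδ]; grind
    have hδ2 : 2 * δ ≤ r₂ := by rw [hδ]; grind
    have hδ3 : 2 * δ ≤ r₃ := by rw [hδ]; grind
    have hδ4 : 2 * δ ≤ r₄ := by rw [hδ]; grind
    refine ⟨Metric.ball (h₀, k₀) δ, mem_nhdsWithin_of_mem_nhds (Metric.ball_mem_nhds _ hδ0),
      δ, hδ0, N, ?_⟩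
    rintro ⟨h, k⟩ hhk n hn D κ hD hκ
    rw [Metric.mem_ball, Prod.dist_eq, max_lt_iff, Real.dist_eq, Real.dist_eq] at hhk
    simp only at hhk hD hκ
    refine hsub (x := (n, mle T D, κ, h, k)) ?_ ⟨n, D, κ, h, k⟩ rfl
    simp only [Set.mem_prod, Set.mem_Ici, Metric.mem_ball, Real.dist_eq]
    have hA := abs_sub_le (mle T D) h h₀
    have hB := abs_sub_le κ k k₀
    exact ⟨hn, by linarith, by linarith, by linarith, by linarith⟩

/-! ### Increments of finite-activity paths along the grid -/

lemma sum_succ_sub_castSucc {n : ℕ} (g : Fin (n + 1) → ℝ) :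
    ∑ i : Fin n, (g i.succ - g i.castSucc) = g (Fin.last n) - g 0 := by
  induction n with
  | zero => simp
  | succ n ih =>
    rw [Fin.sum_univ_castSucc]
    have := ih fun i => g i.castSucc
    simp only [Fin.castSucc_zero, Fin.succ_castSucc] at this ⊢
    rw [this, Fin.succ_last]
    ring

section
variable {T : ℝ≥0}

lemma gridTime_zero (n : ℕ) : gridTime T n 0 = ⟨0, Set.mem_Iic.mpr zero_le⟩ := by
  simp [gridTime]

lemma gridTime_last {n : ℕ} (hn : n ≠ 0) :
    gridTime T n (Fin.last n) = ⟨T, Set.mem_Iic.mpr le_rfl⟩ := by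
  have : (n : ℝ≥0) ≠ 0 := by exact_mod_cast hn
  simp [gridTime, this]

lemma gridTime_mono (n : ℕ) : Monotone (gridTime T n) := by
  intro k l hkl
  rw [Fin.le_def] at hkl
  simp only [gridTime, Subtype.mk_le_mk]
  gcongr

lemma gridTime_succ_sub_castSucc (n : ℕ) (i : Fin n) :
    (((gridTime T n i.succ : ℝ≥0) : ℝ) - ((gridTime T n i.castSucc : ℝ≥0) : ℝ)) = T / n := by
  simp [gridTime]
  ring

lemma sub_eq_sum_of_le {j : Path T} {S : Finset (Set.Iic T)} {a : Set.Iic T → ℝ} {c : ℝ}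
    (h : ∀ t, j t = c + ∑ s ∈ S with s ≤ t, a s) {t t' : Set.Iic T} (htt' : t ≤ t') :
    j t' - j t = ∑ s ∈ S with t < s ∧ s ≤ t', a s := by
  rw [h, h, add_sub_add_left_eq_sub, sub_eq_iff_eq_add, ← Finset.sum_union]
  · refine Finset.sum_congr ?_ fun _ _ => rfl
    ext s
    simp only [Finset.mem_filter, Finset.mem_union]
    constructor
    · rintro ⟨h1, h2⟩
      rcases lt_or_ge t s with h3 | h3
      · exact Or.inl ⟨h1, h3, h2⟩
      · exact Or.inr ⟨h1, h3⟩
    · rintro (⟨h1, -, h2⟩ | ⟨h1, h2⟩)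
      · exact ⟨h1, h2⟩
      · exact ⟨h1, h2.trans htt'⟩
  · rw [Finset.disjoint_filter]
    rintro s - ⟨h1, -⟩ h2
    exact absurd h2 (not_le.mpr h1)

/-- At a positive time, the jump of a path of finite activity is the prescribed jump size. -/
lemma jump_eq {j : Path T} {S : Finset (Set.Iic T)} {a : Set.Iic T → ℝ} {c : ℝ}
    (h : ∀ t, j t = c + ∑ s ∈ S with s ≤ t, a s) {s : Set.Iic T}
    (hs : (⟨0, Set.mem_Iic.mpr zero_le⟩ : Set.Iic T) < s) :
    jump j s = if s ∈ S then a s else 0 := by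
  have hne : (𝓝[<] s).NeBot := nhdsLT_neBot_of_exists_lt ⟨_, hs⟩
  have hev : ∀ᶠ t in 𝓝[<] s, j t = j s - if s ∈ S then a s else 0 := by
    have h1 : ∀ᶠ t in 𝓝[<] s, ∀ r ∈ S, r < s → r < t := by
      rw [eventually_all_finset]
      intro r _
      by_cases hr : r < s
      · filter_upwards [Ioo_mem_nhdsLT hr] with t ht _ using ht.1
      · exact Eventually.of_forall fun t h => absurd h hr
    filter_upwards [h1, self_mem_nhdsWithin] with t ht hts
    rw [eq_sub_iff_add_eq', ← eq_sub_iff_add_eq, sub_eq_sum_of_le h (le_of_lt hts),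
      ← Finset.sum_ite_eq' S s a, Finset.sum_filter]
    refine Finset.sum_congr rfl fun r hr => ?_
    by_cases hrs : r = s
    · subst hrs
      have : t < r ∧ r ≤ r := ⟨hts, le_rfl⟩
      simp [this]
    · have : ¬ (t < r ∧ r ≤ s) := fun hh =>
        absurd (ht r hr (lt_of_le_of_ne hh.2 hrs)) (not_lt.mpr hh.1.le)
      simp [this, hrs]
  rw [jump, leftLim_eq_of_tendsto (tendsto_const_nhds.congr' (hev.mono fun t ht => ht.symm))]
  ring

lemma jumpQV_eq {j : Path T} {S : Finset (Set.Iic T)} {a : Set.Iic T → ℝ} {c : ℝ}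
    (h : ∀ t, j t = c + ∑ s ∈ S with s ≤ t, a s) :
    jumpQV j = ∑ s ∈ S with (⟨0, Set.mem_Iic.mpr zero_le⟩ : Set.Iic T) < s, a s ^ 2 := by
  have hzero : ∀ s : Set.Iic T, ¬ (⟨0, Set.mem_Iic.mpr zero_le⟩ : Set.Iic T) < s → jump j s = 0 := by
    intro s hs
    have hbot : IsBot s := fun t => (not_lt.mp hs).trans (Subtype.mk_le_mk.mpr zero_le)
    rw [jump, leftLim_eq_of_isBot hbot, sub_self]
  rw [jumpQV, finsum_eq_sum_of_support_subset
    (s := S.filter fun s => (⟨0, Set.mem_Iic.mpr zero_le⟩ : Set.Iic T) < s)]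
  · refine Finset.sum_congr rfl fun s hs => ?_
    rw [Finset.mem_filter] at hs
    rw [jump_eq h hs.2, if_pos hs.1]
  · intro s hs
    rw [Function.mem_support] at hs
    have h0 : (⟨0, Set.mem_Iic.mpr zero_le⟩ : Set.Iic T) < s := by
      by_contra h0
      simp [hzero s h0] at hs
    rw [Finset.mem_coe, Finset.mem_filter]
    refine ⟨?_, h0⟩
    by_contra hsS
    simp [jump_eq h h0, hsS] at hs

/-- As soon as every grid cell contains at most one jump time, the sum of squared increments along
the grid is exactly the quadratic variation. -/
lemma IsFiniteActivityPath.eventually_sum_sq_eq_jumpQV {j : Path T} (hj : IsFiniteActivityPath j) :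
    ∀ᶠ n : ℕ in atTop, ∑ i : Fin n,
      (j (gridTime T n i.succ) - j (gridTime T n i.castSucc)) ^ 2 = jumpQV j := by
  obtain ⟨S, a, h⟩ := hj
  have hsep : ∀ᶠ n : ℕ in atTop, ∀ r ∈ S, ∀ s ∈ S, r < s →
      (T : ℝ) / n < ((s : ℝ≥0) : ℝ) - ((r : ℝ≥0) : ℝ) := by
    simp only [eventually_all_finset]
    intro r _ s _
    by_cases hrs : r < s
    · have hrs' : ((r : ℝ≥0) : ℝ) < ((s : ℝ≥0) : ℝ) := by exact_mod_cast hrs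
      filter_upwards [(tendsto_const_div_atTop_nhds_zero_nat (T : ℝ)).eventually_lt_const
        (sub_pos.mpr hrs')] with n hn _ using hn
    · exact Eventually.of_forall fun n h => absurd h hrs
  filter_upwards [hsep, eventually_ne_atTop 0] with n hn hn0
  rw [jumpQV_eq h]
  have hcell : ∀ i : Fin n, (j (gridTime T n i.succ) - j (gridTime T n i.castSucc)) ^ 2
      = ∑ s ∈ S, ((if s ≤ gridTime T n i.succ then a s ^ 2 else 0) -
        if s ≤ gridTime T n i.castSucc then a s ^ 2 else 0) := by
    intro i
    have hle : gridTime T n i.castSucc ≤ gridTime T n i.succ :=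
      gridTime_mono n (Fin.castSucc_lt_succ (i := i)).le
    rw [sub_eq_sum_of_le h hle]
    set F := S.filter fun s => gridTime T n i.castSucc < s ∧ s ≤ gridTime T n i.succ with hF
    have hF1 : ∀ r ∈ F, ∀ s ∈ F, ¬ r < s := by
      intro r hr s hs hrs
      rw [hF, Finset.mem_filter] at hr hs
      have h1 := hn r hr.1 s hs.1 hrs
      rw [← gridTime_succ_sub_castSucc n i] at h1
      have h2 : ((gridTime T n i.castSucc : ℝ≥0) : ℝ) < ((r : ℝ≥0) : ℝ) := by exact_mod_cast hr.2.1
      have h3 : ((s : ℝ≥0) : ℝ) ≤ ((gridTime T n i.succ : ℝ≥0) : ℝ) := by exact_mod_cast hs.2.2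
      linarith
    have hF2 : F.card ≤ 1 := Finset.card_le_one.mpr fun r hr s hs =>
      le_antisymm (not_lt.mp (hF1 s hs r hr)) (not_lt.mp (hF1 r hr s hs))
    have hF3 : (∑ s ∈ F, a s) ^ 2 = ∑ s ∈ F, a s ^ 2 := by
      rcases Nat.le_one_iff_eq_zero_or_eq_one.mp hF2 with h0 | h1
      · rw [Finset.card_eq_zero.mp h0]; simp
      · obtain ⟨x, hx⟩ := Finset.card_eq_one.mp h1
        simp [hx]
    rw [hF3, hF, Finset.sum_filter]
    refine Finset.sum_congr rfl fun s _ => ?_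
    by_cases h1 : s ≤ gridTime T n i.castSucc
    · simp [h1, h1.trans hle]
    · simp [h1, not_le.mp h1]
  -- for each jump time the sum over the cells telescopes to the indicator of `0 < s ≤ T`
  rw [Finset.sum_congr rfl fun i _ => hcell i, Finset.sum_comm, Finset.sum_filter]
  refine Finset.sum_congr rfl fun s _ => ?_
  rw [sum_succ_sub_castSucc (fun k => if s ≤ gridTime T n k then a s ^ 2 else 0),
    gridTime_zero, gridTime_last hn0, if_pos (Subtype.mk_le_mk.mpr s.2)]
  by_cases h0 : (⟨0, Set.mem_Iic.mpr zero_le⟩ : Set.Iic T) < s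
  · simp [h0, not_le.mpr h0]
  · simp [h0, not_lt.mp h0]

lemma IsFiniteActivityPath.tendsto_sum_sq_add_drift {j : Path T} (hj : IsFiniteActivityPath j)
    (β : ℝ) : Tendsto (fun n : ℕ => ∑ i : Fin n, (β * (T / n) +
      (j (gridTime T n i.succ) - j (gridTime T n i.castSucc))) ^ 2) atTop (𝓝 (jumpQV j)) := by
  set d : ℝ := j ⟨T, Set.mem_Iic.mpr le_rfl⟩ - j ⟨0, Set.mem_Iic.mpr zero_le⟩
  have h0 := tendsto_const_div_atTop_nhds_zero_nat (T : ℝ)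
  have hlim : Tendsto (fun n : ℕ => (β ^ 2 * T + 2 * β * d) * (T / n) + jumpQV j) atTop
      (𝓝 (jumpQV j)) := by
    simpa using (h0.const_mul (β ^ 2 * T + 2 * β * d)).add_const (jumpQV j)
  refine hlim.congr' ?_
  filter_upwards [hj.eventually_sum_sq_eq_jumpQV, eventually_ne_atTop 0] with n hn hn0
  have hn0' : (n : ℝ) ≠ 0 := by exact_mod_cast hn0
  have hd : ∑ i : Fin n, (j (gridTime T n i.succ) - j (gridTime T n i.castSucc)) = d := by
    rw [sum_succ_sub_castSucc (fun k => j (gridTime T n k)), gridTime_zero, gridTime_last hn0]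
  simp_rw [add_sq]
  rw [Finset.sum_add_distrib, Finset.sum_add_distrib, hn, ← Finset.mul_sum, hd]
  simp only [Finset.sum_const, Finset.card_univ, Fintype.card_fin, nsmul_eq_mul]
  field_simp
end

/-! ### Squared Gaussian increments -/

lemma memLp_sq_gaussianReal (v : ℝ≥0) : MemLp (fun x : ℝ => x ^ 2) 2 (gaussianReal 0 v) := by
  have h : MemLp (id : ℝ → ℝ) (4 : ℝ≥0) (gaussianReal 0 v) := memLp_id_gaussianReal 4
  have h2 : MemLp (fun x : ℝ => ‖x‖ ^ (2 : ℝ)) ((4 : ℝ≥0) / 2) (gaussianReal 0 v) := by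
    simpa using h.norm_rpow_div 2
  have h3 : (((4 : ℝ≥0) : ℝ≥0∞) / 2) = 2 := by
    rw [show ((4 : ℝ≥0) : ℝ≥0∞) = 2 * 2 by norm_num, mul_div_assoc,
      ENNReal.div_self (by norm_num) (by norm_num), mul_one]
  rw [h3] at h2
  refine h2.congr_norm (by fun_prop) (ae_of_all _ fun x => ?_)
  simp

lemma variance_sq_gaussianReal (v : ℝ≥0) :
    Var[fun x => x ^ 2; gaussianReal 0 v] = v ^ 2 * Var[fun x => x ^ 2; gaussianReal 0 1] := by
  have h : gaussianReal 0 v = (gaussianReal 0 1).map (fun x => √v * x) := by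
    rw [gaussianReal_map_const_mul]
    congr 1
    · simp
    · ext; simp
  rw [h, variance_map (by fun_prop) (by fun_prop)]
  have : (fun x : ℝ => x ^ 2) ∘ (fun x => √(v : ℝ) * x) = fun x => (v : ℝ) * x ^ 2 := by
    ext x
    simp [mul_pow]
  rw [this, variance_const_mul]

lemma integral_sq_gaussianReal (v : ℝ≥0) : ∫ x, x ^ 2 ∂gaussianReal 0 v = v := by
  have h := variance_fun_id_gaussianReal (μ := 0) (v := v)
  rw [variance_eq_integral (by fun_prop)] at h
  simpa using h

lemma variance_add_le {Ω : Type*} [MeasurableSpace Ω] {P : Measure Ω} [IsProbabilityMeasure P]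
    {X Y : Ω → ℝ} (hX : MemLp X 2 P) (hY : MemLp Y 2 P) :
    Var[fun ω => X ω + Y ω; P] ≤ 2 * Var[X; P] + 2 * Var[Y; P] := by
  have h1 := variance_fun_add hX hY
  have h2 := variance_fun_sub hX hY
  have h3 := variance_nonneg (fun ω => X ω - Y ω) P
  linarith

section
variable {Ω : Type*} [MeasurableSpace Ω] {P : Measure Ω} [IsProbabilityMeasure P]

lemma memLp_sq_add_gaussian {v : ℝ≥0} (m s : ℝ) :
    MemLp (fun x : ℝ => (m + s * x) ^ 2) 2 (gaussianReal 0 v) := by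
  have h1 := (memLp_sq_gaussianReal v).const_mul (s ^ 2)
  have h2 : MemLp (fun x : ℝ => 2 * m * s * x) 2 (gaussianReal 0 v) :=
    (memLp_id_gaussianReal 2).const_mul (2 * m * s)
  have h3 := (h1.add h2).add (memLp_const (m ^ 2))
  convert h3 using 1
  ext x
  simp only [Pi.add_apply]
  ring

lemma integral_sq_add_gaussian {v : ℝ≥0} (m s : ℝ) :
    ∫ x, (m + s * x) ^ 2 ∂gaussianReal 0 v = m ^ 2 + s ^ 2 * v := by
  have h1 : Integrable (fun x : ℝ => s ^ 2 * x ^ 2) (gaussianReal 0 v) :=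
    ((memLp_sq_gaussianReal v).integrable (by norm_num)).const_mul _
  have h2 : Integrable (fun x : ℝ => 2 * m * s * x) (gaussianReal 0 v) :=
    ((memLp_id_gaussianReal 1).integrable le_rfl).const_mul _
  have h3 : ∀ x : ℝ, (m + s * x) ^ 2 = m ^ 2 + 2 * m * s * x + s ^ 2 * x ^ 2 := fun x => by ring
  simp_rw [h3]
  have h4 : Integrable (fun x : ℝ => m ^ 2 + 2 * m * s * x) (gaussianReal 0 v) :=
    (integrable_const _).add h2
  rw [integral_add h4 h1, integral_add (integrable_const _) h2,
    integral_const_mul, integral_const_mul, integral_sq_gaussianReal]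
  have := integral_id_gaussianReal (μ := 0) (v := v)
  simp [this]

lemma variance_sq_add_gaussian_le {v : ℝ≥0} (m s : ℝ) :
    Var[fun x => (m + s * x) ^ 2; gaussianReal 0 v]
      ≤ 2 * (s ^ 2 * v) ^ 2 * Var[fun x => x ^ 2; gaussianReal 0 1] + 8 * (s ^ 2 * v) * m ^ 2 := by
  have h1 := (memLp_sq_gaussianReal v).const_mul (s ^ 2)
  have h2 : MemLp (fun x : ℝ => 2 * m * s * x) 2 (gaussianReal 0 v) :=
    (memLp_id_gaussianReal 2).const_mul (2 * m * s)
  have h3 : (fun x : ℝ => (m + s * x) ^ 2)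
      = fun x => (s ^ 2 * x ^ 2 + 2 * m * s * x) + m ^ 2 := by ext x; ring
  rw [h3, variance_add_const (by fun_prop)]
  refine (variance_add_le h1 h2).trans (le_of_eq ?_)
  rw [variance_const_mul, variance_const_mul, variance_sq_gaussianReal,
    variance_fun_id_gaussianReal]
  ring

/-- Chebyshev's inequality for a sum of squares of independent `N(mᵢ, s ^ 2 v)` variables. The fourth
moment of the standard normal law is kept as an unevaluated variance. -/
lemma measure_sum_sq_deviation_le {n : ℕ} {Z : Fin n → Ω → ℝ} {v : ℝ≥0}
    (hZ : iIndepFun Z P) (hlaw : ∀ i, HasLaw (Z i) (gaussianReal 0 v) P) (m : Fin n → ℝ) (s : ℝ)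
    {c : ℝ} (hc : 0 < c) :
    P {ω | c ≤ |∑ i, (m i + s * Z i ω) ^ 2 - (∑ i, m i ^ 2 + n * (s ^ 2 * v))|} ≤
      ENNReal.ofReal ((2 * (n * (s ^ 2 * v) ^ 2) * Var[fun x => x ^ 2; gaussianReal 0 1]
        + 8 * (s ^ 2 * v) * ∑ i, m i ^ 2) / c ^ 2) := by
  set Y : Fin n → Ω → ℝ := fun i ω => (m i + s * Z i ω) ^ 2 with hY
  have hYL : ∀ i, MemLp (Y i) 2 P := by
    intro i
    have h := memLp_sq_add_gaussian (v := v) (m i) s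
    rw [← (hlaw i).map_eq] at h
    exact h.comp_of_map (hlaw i).aemeasurable
  have hYint : ∀ i, ∫ ω, Y i ω ∂P = m i ^ 2 + s ^ 2 * v := by
    intro i
    rw [← integral_sq_add_gaussian (v := v) (m i) s]
    exact (hlaw i).integral_comp (f := fun x => (m i + s * x) ^ 2) (by fun_prop)
  have hYvar : ∀ i, Var[Y i; P] ≤ 2 * (s ^ 2 * v) ^ 2 * Var[fun x => x ^ 2; gaussianReal 0 1]
      + 8 * (s ^ 2 * v) * m i ^ 2 := by
    intro i
    refine le_trans (le_of_eq ?_) (variance_sq_add_gaussian_le (v := v) (m i) s)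
    rw [← (hlaw i).map_eq, variance_map (by fun_prop) (hlaw i).aemeasurable]
    rfl
  have hind : iIndepFun Y P := hZ.comp (fun i x => (m i + s * x) ^ 2) (fun i => by fun_prop)
  have hsum : MemLp (∑ i, Y i) 2 P := memLp_finsetSum' _ fun i _ => hYL i
  have hE : ∫ ω, (∑ i, Y i) ω ∂P = ∑ i, m i ^ 2 + n * (s ^ 2 * v) := by
    simp only [Finset.sum_apply]
    rw [integral_finsetSum _ fun i _ => (hYL i).integrable (by norm_num)]
    simp_rw [hYint]
    rw [Finset.sum_add_distrib]
    simp
  have hV : Var[∑ i, Y i; P] ≤ 2 * (n * (s ^ 2 * v) ^ 2) * Var[fun x => x ^ 2; gaussianReal 0 1]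
        + 8 * (s ^ 2 * v) * ∑ i, m i ^ 2 := by
    rw [IndepFun.variance_sum (fun i _ => hYL i) fun i _ k _ hik => hind.indepFun hik]
    refine (Finset.sum_le_sum fun i _ => hYvar i).trans (le_of_eq ?_)
    rw [Finset.sum_add_distrib, Finset.sum_const, ← Finset.mul_sum, Finset.card_univ,
      Fintype.card_fin, nsmul_eq_mul]
    ring
  have hcheb := meas_ge_le_variance_div_sq hsum hc
  rw [hE] at hcheb
  simp only [Finset.sum_apply, hY] at hcheb
  refine hcheb.trans (ENNReal.ofReal_le_ofReal ?_)
  gcongr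

/-- The increments for a deterministic jump path `j`; their law is the conditional law of the
increments given `J = j`. -/
lemma increments_const_eq {Ω : Type*} {T : ℝ≥0} (β θ : ℝ) (W : ℝ≥0 → Ω → ℝ) (j : Path T) (n : ℕ) (ω : Ω)
    (i : Fin n) : increments β θ W (fun _ => j) n ω i = (β * (T / n) +
      (j (gridTime T n i.succ) - j (gridTime T n i.castSucc))) +
      √θ * (W (gridTime T n i.succ) ω - W (gridTime T n i.castSucc) ω) := by
  rw [increments, process, process, ← gridTime_succ_sub_castSucc n i]
  ring

/-- For a fixed jump path, the estimator is consistent for the pseudo-true value. -/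
lemma tendsto_measure_mle_sub_pseudoTrue {T : ℝ≥0} (hT : 0 < T) (β : ℝ) {θ : ℝ} (hθ : 0 < θ)
    {W : ℝ≥0 → Ω → ℝ} (hW : IsBrownianReal W P) {j : Path T} (hj : IsFiniteActivityPath j)
    {δ : ℝ} (hδ : 0 < δ) :
    Tendsto (fun n => P {ω | δ ≤ |mle T (increments β θ W (fun _ => j) n ω) - pseudoTrue θ j|})
      atTop (𝓝 0) := by
  have hT' : (0 : ℝ) < T := hT
  set m : ∀ n, Fin n → ℝ := fun n i => β * (T / n) +
      (j (gridTime T n i.succ) - j (gridTime T n i.castSucc))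
  set Z : ∀ n, Fin n → Ω → ℝ := fun n i ω =>
    W (gridTime T n i.succ) ω - W (gridTime T n i.castSucc) ω
  have hm : Tendsto (fun n => ∑ i, m n i ^ 2) atTop (𝓝 (jumpQV j)) := hj.tendsto_sum_sq_add_drift β
  have hmle : ∀ n ω, mle T (increments β θ W (fun _ => j) n ω)
      = (T : ℝ)⁻¹ * ∑ i, (m n i + √θ * Z n i ω) ^ 2 := by
    intro n ω
    rw [mle]
    congr 1
    exact Finset.sum_congr rfl fun i _ => by rw [increments_const_eq]
  have hZ : ∀ n, iIndepFun (Z n) P := fun n => hW.hasIndepIncrements n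
    (fun k => gridTime T n k) fun k l hkl => gridTime_mono n hkl
  have hlaw : ∀ n i, HasLaw (Z n i) (gaussianReal 0 (T / n)) P := by
    intro n i
    have h := hW.hasLaw_sub (gridTime T n i.succ) (gridTime T n i.castSucc)
    have hd : nndist ((gridTime T n i.succ : ℝ≥0) : ℝ) ((gridTime T n i.castSucc : ℝ≥0) : ℝ)
        = T / n := by
      apply NNReal.coe_injective
      rw [coe_nndist, Real.dist_eq, gridTime_succ_sub_castSucc, abs_of_nonneg (by positivity)]
      simp
    rw [← hd]
    exact h
  set V := Var[fun x => x ^ 2; gaussianReal 0 1]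
  have h0 := tendsto_const_div_atTop_nhds_zero_nat (T : ℝ)
  have hlim : Tendsto (fun n : ℕ => ENNReal.ofReal ((2 * (θ ^ 2 * T * (T / n)) * V
      + 8 * (θ * (T / n)) * ∑ i, m n i ^ 2) / (T * δ / 2) ^ 2)) atTop (𝓝 0) := by
    have h1 := ((((h0.const_mul (θ ^ 2 * T)).const_mul 2).mul_const V).add
      (((h0.const_mul θ).const_mul 8).mul hm)).div_const ((T * δ / 2) ^ 2)
    simpa using ENNReal.tendsto_ofReal h1
  refine tendsto_of_tendsto_of_tendsto_of_le_of_le' tendsto_const_nhds hlim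
    (Eventually.of_forall fun n => zero_le) ?_
  have hclose : ∀ᶠ n in atTop, |∑ i, m n i ^ 2 - jumpQV j| < T * δ / 2 := by
    have := hm.eventually (Metric.ball_mem_nhds _ (show 0 < T * δ / 2 by positivity))
    simpa [Real.dist_eq] using this
  filter_upwards [hclose, eventually_ne_atTop 0] with n hn hn0
  have hn' : (n : ℝ) ≠ 0 := by exact_mod_cast hn0
  have hcheb := measure_sum_sq_deviation_le (hZ n) (hlaw n) (m n) √θ
    (show 0 < T * δ / 2 by positivity)
  rw [Real.sq_sqrt hθ.le, NNReal.coe_div, NNReal.coe_natCast] at hcheb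
  refine le_trans (measure_mono fun ω hω => ?_) (hcheb.trans (le_of_eq ?_))
  · change δ ≤ _ at hω
    change T * δ / 2 ≤ _
    rw [hmle, pseudoTrue] at hω
    have h1 : n * (θ * (T / n)) = (T : ℝ) * θ := by field_simp
    rw [h1]
    have h2 : (T : ℝ)⁻¹ * ∑ i, (m n i + √θ * Z n i ω) ^ 2 - (θ + (T : ℝ)⁻¹ * jumpQV j)
        = (T : ℝ)⁻¹ * ((∑ i, (m n i + √θ * Z n i ω) ^ 2 - (∑ i, m n i ^ 2 + T * θ))
          + (∑ i, m n i ^ 2 - jumpQV j)) := by field_simp; ring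
    rw [h2, abs_mul, abs_of_pos (inv_pos.mpr hT'), ← div_eq_inv_mul, le_div_iff₀ hT'] at hω
    have h3 := abs_add_le (∑ i, (m n i + √θ * Z n i ω) ^ 2 - (∑ i, m n i ^ 2 + T * θ))
      (∑ i, m n i ^ 2 - jumpQV j)
    linarith
  · rw [show n * (θ * (T / n)) ^ 2 = θ ^ 2 * T * (T / n) by field_simp]
end

/-! ### Conditioning on the jump path -/

section
variable {Ω β γ E : Type*} [MeasurableSpace Ω] [MeasurableSpace β] [MeasurableSpace γ]
  [MeasurableSpace E] [StandardBorelSpace E] [Nonempty E] {P : Measure Ω} [IsProbabilityMeasure P]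

/-- If `V` is independent of `X`, the conditional law of `F (X, V)` given `X = b` is the law of
`F (b, V)`. -/
lemma condDistrib_ae_eq_map_of_indepFun {X : Ω → β} {V : Ω → γ} (hX : Measurable X)
    (hV : Measurable V) (hind : IndepFun V X P) {F : β × γ → E} (hF : Measurable F) :
    ∀ᵐ b ∂P.map X, condDistrib (fun ω => F (X ω, V ω)) X P b = P.map fun ω => F (b, V ω) := by
  have : IsProbabilityMeasure (P.map V) := Measure.isProbabilityMeasure_map hV.aemeasurable
  have : IsProbabilityMeasure (P.map X) := Measure.isProbabilityMeasure_map hX.aemeasurable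
  let K : Kernel β E := (Kernel.id ×ₖ Kernel.const β (P.map V)).map F
  have hK : ∀ b, K b = P.map fun ω => F (b, V ω) := by
    intro b
    rw [Kernel.map_apply _ hF, Kernel.prod_apply, Kernel.id_apply, Kernel.const_apply,
      Measure.dirac_prod, Measure.map_map hF (by fun_prop), Measure.map_map (by fun_prop) hV]
    rfl
  have : IsMarkovKernel K := Kernel.IsMarkovKernel.map _ hF
  have h := condDistrib_ae_eq_of_measure_eq_compProd (μ := P) X (κ := K)
    (Y := fun ω => F (X ω, V ω)) (by fun_prop) ?_
  · filter_upwards [h] with b hb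
    rw [hb, hK]
  · ext s hs
    have hpair : P.map (fun ω => (X ω, V ω)) = (P.map X).prod (P.map V) :=
      (indepFun_iff_map_prod_eq_prod_map_map hX.aemeasurable hV.aemeasurable).mp hind.symm
    have hG : Measurable fun p : β × γ => (p.1, F p) := by fun_prop
    have h1 : P.map (fun ω => (X ω, F (X ω, V ω))) = ((P.map X).prod (P.map V)).map
        fun p => (p.1, F p) := by
      rw [← hpair, Measure.map_map hG (by fun_prop)]; rfl
    rw [h1, Measure.map_apply hG hs, Measure.prod_apply (hG hs), Measure.compProd_apply hs]
    refine lintegral_congr fun b => ?_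
    rw [hK, Measure.map_apply (by fun_prop) (measurable_prodMk_left hs),
      Measure.map_apply hV (measurable_prodMk_left (hG hs))]
    rfl

lemma measure_eq_lintegral_condDistrib {X : Ω → β} {Y : Ω → E} (hX : Measurable X)
    (hY : Measurable Y) {A : Set (β × E)} (hA : MeasurableSet A) :
    P {ω | (X ω, Y ω) ∈ A} = ∫⁻ ω, condDistrib Y X P (X ω) {y | (X ω, y) ∈ A} ∂P := by
  have h := compProd_map_condDistrib (mβ := inferInstance) (μ := P) (X := X) hY.aemeasurable
  have h1 : P {ω | (X ω, Y ω) ∈ A} = (P.map fun ω => (X ω, Y ω)) A :=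
    (Measure.map_apply (by fun_prop) hA).symm
  rw [h1, ← h, Measure.compProd_apply hA, lintegral_map (Kernel.measurable_kernel_prodMk_left hA) hX]
  rfl

/-- Conditional convergence in probability along almost every value of `X` implies unconditional
convergence, by dominated convergence. -/
lemma tendsto_measure_of_tendsto_condDistrib {E : ℕ → Type*} [∀ n, MeasurableSpace (E n)]
    [∀ n, StandardBorelSpace (E n)] [∀ n, Nonempty (E n)] {X : Ω → β} {Y : ∀ n, Ω → E n}
    (hX : Measurable X) (hY : ∀ n, Measurable (Y n)) {A : ∀ n, Set (β × E n)}
    (hA : ∀ n, MeasurableSet (A n))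
    (h : ∀ᵐ ω ∂P, Tendsto (fun n => condDistrib (Y n) X P (X ω) {y | (X ω, y) ∈ A n})
      atTop (𝓝 0)) : Tendsto (fun n => P {ω | (X ω, Y n ω) ∈ A n}) atTop (𝓝 0) := by
  simp_rw [fun n => measure_eq_lintegral_condDistrib (P := P) hX (hY n) (hA n)]
  rw [show (0 : ℝ≥0∞) = ∫⁻ _ : Ω, 0 ∂P by simp]
  refine tendsto_lintegral_of_dominated_convergence (fun _ => 1) (fun n => ?_) (fun n => ?_)
    (by simp) h
  · exact (Kernel.measurable_kernel_prodMk_left (hA n)).comp hX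
  · exact ae_of_all _ fun ω => prob_le_one
end

variable {Ω : Type*} [MeasurableSpace Ω] {P : Measure Ω} [IsProbabilityMeasure P] {T : ℝ≥0}

lemma pseudoTrue_pos {θ : ℝ} (hθ : 0 < θ) (j : Path T) : 0 < pseudoTrue θ j := by
  have : 0 ≤ jumpQV j := finsum_nonneg fun s => sq_nonneg _
  unfold pseudoTrue
  positivity

/-- The pseudo-true value agrees with a cylinder-measurable function on paths of finite activity.
`jumpQV` itself depends on uncountably many coordinates, whereas the limit of squared increments
along the grids involves countably many. -/
lemma exists_measurable_eq_pseudoTrue (T : ℝ≥0) (θ : ℝ) :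
    ∃ g : Path T → ℝ, Measurable g ∧ ∀ j, IsFiniteActivityPath j → g j = pseudoTrue θ j := by
  let q : ℕ → Path T → ℝ := fun n j => ∑ i : Fin n,
    (j (gridTime T n i.succ) - j (gridTime T n i.castSucc)) ^ 2
  have hq : ∀ n, Measurable (q n) := fun n => by fun_prop
  refine ⟨fun j => θ + (T : ℝ)⁻¹ * limUnder atTop fun n => q n j, ?_, fun j hj => ?_⟩
  · have := (StronglyMeasurable.limUnder (l := atTop) fun n => (hq n).stronglyMeasurable).measurable
    fun_prop
  · have h : Tendsto (fun n => q n j) atTop (𝓝 (jumpQV j)) :=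
      tendsto_const_nhds.congr' (hj.eventually_sum_sq_eq_jumpQV.mono fun n hn => hn.symm)
    simp only [h.limUnder_eq, pseudoTrue]

@[fun_prop]
lemma measurable_mle (T : ℝ≥0) (n : ℕ) : Measurable fun D : Fin n → ℝ => mle T D := by
  unfold mle; fun_prop

lemma measurable_increments {β θ : ℝ} {W : ℝ≥0 → Ω → ℝ} (hWm : ∀ t, Measurable (W t))
    {J : Ω → Path T} (hJm : Measurable J) (n : ℕ) : Measurable (increments β θ W J n) := by
  unfold increments process
  refine measurable_pi_lambda _ fun i => ?_
  have := fun t => (measurable_pi_apply t).comp hJm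
  simp only [Function.comp_def] at this
  fun_prop

/-- For almost every path `J`, the conditional law of the increments is their law with the jump path
frozen. The exceptional null set is chosen simultaneously for all `n`. -/
lemma ae_condLaw_fst_eq {β θ : ℝ} {W : ℝ≥0 → Ω → ℝ} (hWm : ∀ t, Measurable (W t))
    {J : Ω → Path T} (hJm : Measurable J) (hWJ : IndepFun (fun ω t => W t ω) J P)
    {κ : ℕ → Ω → ℝ} (hκm : ∀ n, Measurable (κ n)) :
    ∀ᵐ ω ∂P, ∀ n, ∀ A : Set (Fin n → ℝ), MeasurableSet A →
      condLaw P β θ W J κ n (J ω) {x | x.1 ∈ A} =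
        P {ω' | increments β θ W (fun _ => J ω) n ω' ∈ A} := by
  rw [ae_all_iff]
  intro n
  let V : Ω → Fin n → ℝ := fun ω i => W (gridTime T n i.succ) ω - W (gridTime T n i.castSucc) ω
  have hV : Measurable V := by fun_prop
  let F : Path T × (Fin n → ℝ) → Fin n → ℝ := fun p i => (β * (T / n) +
      (p.1 (gridTime T n i.succ) - p.1 (gridTime T n i.castSucc))) + √θ * p.2 i
  have hF : Measurable F := by fun_prop
  have hind : IndepFun V J P :=
    hWJ.comp (φ := fun w : ℝ≥0 → ℝ => fun i : Fin n =>
      w (gridTime T n i.succ) - w (gridTime T n i.castSucc)) (ψ := id) (by fun_prop) measurable_id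
  have hFc : ∀ j, (fun ω => F (j, V ω)) = increments β θ W (fun _ => j) n := by
    intro j
    ext ω i
    rw [increments_const_eq]
  have hFJ : (fun ω => F (J ω, V ω)) = increments β θ W J n := by
    ext ω
    exact congrFun (congrFun (hFc (J ω)) ω) _
  have h1 := condDistrib_ae_eq_map_of_indepFun hJm hV hind hF
  rw [hFJ] at h1
  have hincr := measurable_increments (β := β) (θ := θ) hWm hJm n
  have h2 := condDistrib_comp (mβ := inferInstance) (μ := P) J (Y := fun ω => (increments β θ W J n ω, κ n ω))
    (hincr.prodMk (hκm n)).aemeasurable (measurable_fst (α := Fin n → ℝ) (β := ℝ))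
  filter_upwards [ae_of_ae_map hJm.aemeasurable h1, ae_of_ae_map hJm.aemeasurable h2]
    with ω hω1 hω2 A hA
  have h3 : condDistrib (increments β θ W J n) J P (J ω)
      = (condLaw P β θ W J κ n).map Prod.fst (J ω) := hω2
  rw [hω1, hFc, Kernel.map_apply _ measurable_fst] at h3
  have hcm : Measurable (increments β θ W (fun _ : Ω => J ω) n) :=
    measurable_increments hWm measurable_const n
  have h4 := DFunLike.congr_fun h3 A
  rw [Measure.map_apply hcm hA, Measure.map_apply measurable_fst hA] at h4
  exact h4.symm

/-! ### The Bernstein–von Mises limit -/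

lemma ae_tendsto_condLaw_mle (hT : 0 < T) (β : ℝ) {θ : ℝ} (hθ : 0 < θ)
    {W : ℝ≥0 → Ω → ℝ} (hW : IsBrownianReal W P) (hWm : ∀ t, Measurable (W t))
    {J : Ω → Path T} (hJm : Measurable J) (hJ : ∀ᵐ ω ∂P, IsFiniteActivityPath (J ω))
    (hWJ : IndepFun (fun ω t => W t ω) J P) {κ : ℕ → Ω → ℝ} (hκm : ∀ n, Measurable (κ n)) :
    ∀ᵐ ω ∂P, ∀ δ > 0, Tendsto (fun n => condLaw P β θ W J κ n (J ω)
      {x | δ ≤ |mle T x.1 - pseudoTrue θ (J ω)|}) atTop (𝓝 0) := by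
  filter_upwards [ae_condLaw_fst_eq hWm hJm hWJ hκm, hJ] with ω hω hJω δ hδ
  refine (tendsto_measure_mle_sub_pseudoTrue hT β hθ hW hJω hδ).congr fun n => ?_
  exact (hω n {D | δ ≤ |mle T D - pseudoTrue θ (J ω)|}
    (measurableSet_le measurable_const (by fun_prop))).symm

/-- Convergence in conditional probability, for almost every jump path. -/
lemma bernsteinVonMises_conditional (hT : 0 < T) (β : ℝ) {θ : ℝ} (hθ : 0 < θ)
    {W : ℝ≥0 → Ω → ℝ} (hW : IsBrownianReal W P) (hWm : ∀ t, Measurable (W t))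
    {J : Ω → Path T} (hJm : Measurable J) (hJ : ∀ᵐ ω ∂P, IsFiniteActivityPath (J ω))
    (hWJ : IndepFun (fun ω t => W t ω) J P) {κ : ℕ → Ω → ℝ} (hκm : ∀ n, Measurable (κ n))
    {π : ℝ → ℝ} (hπm : Measurable π) (hπ0 : ∀ t > 0, 0 ≤ π t)
    (hπ1 : ∫⁻ t in Set.Ioi 0, ENNReal.ofReal (π t) = 1) :
    ∀ᵐ ω ∂P, ∀ κ' > 0, TemperatureTendsto P β θ W J κ (J ω) κ' →
      (∀ᶠ t in 𝓝 (pseudoTrue θ (J ω)), ContinuousAt π t ∧ 0 < π t) →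
      ∀ ε > 0, Tendsto (fun n => condLaw P β θ W J κ n (J ω)
        {x | ε ≤ bvmDist T π x.1 x.2 κ' (pseudoTrue θ (J ω))}) atTop (𝓝 0) := by
  filter_upwards [ae_tendsto_condLaw_mle hT β hθ hW hWm hJm hJ hWJ hκm]
    with ω hmle κ' hκ' hκ hπ ε hε
  obtain ⟨hπc, hπp⟩ := hπ.self_of_nhds
  obtain ⟨δ, hδ, N, hN⟩ := exists_forall_bvmDist_lt hT hπm hπ0 hπ1
    (K := {(pseudoTrue θ (J ω), κ')}) isCompact_singleton
    (by rintro p rfl; exact ⟨pseudoTrue_pos hθ _, hκ', hπc, hπp⟩) hε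
  have hlim := (hmle δ hδ).add (hκ δ hδ)
  rw [add_zero] at hlim
  refine tendsto_of_tendsto_of_tendsto_of_le_of_le' tendsto_const_nhds hlim
    (Eventually.of_forall fun n => zero_le) ?_
  filter_upwards [eventually_ge_atTop N] with n hn
  refine (measure_mono fun x hx => ?_).trans (measure_union_le _ _)
  by_contra hx'
  rw [Set.mem_union, not_or] at hx'
  exact absurd (hN _ rfl n hn x.1 x.2 (not_le.mp hx'.1) (not_le.mp hx'.2)) (not_lt.mpr hx)

/-- Convergence in unconditional probability. The pair `(θ†, κ†)` lies in the open set where the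
deterministic limit applies; by tightness it lies in a compact subset with probability close to
`1`, and there the deterministic limit is uniform. -/
lemma bernsteinVonMises_unconditional (hT : 0 < T) (β : ℝ) {θ : ℝ} (hθ : 0 < θ)
    {W : ℝ≥0 → Ω → ℝ} (hW : IsBrownianReal W P) (hWm : ∀ t, Measurable (W t))
    {J : Ω → Path T} (hJm : Measurable J) (hJ : ∀ᵐ ω ∂P, IsFiniteActivityPath (J ω))
    (hWJ : IndepFun (fun ω t => W t ω) J P) {κ : ℕ → Ω → ℝ} (hκm : ∀ n, Measurable (κ n))
    {π : ℝ → ℝ} (hπm : Measurable π) (hπ0 : ∀ t > 0, 0 ≤ π t)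
    (hπ1 : ∫⁻ t in Set.Ioi 0, ENNReal.ofReal (π t) = 1)
    {κ' : Ω → ℝ} (hκ'm : AEStronglyMeasurable[MeasurableSpace.comap J inferInstance] κ' P)
    (hκ' : ∀ᵐ ω ∂P, 0 < κ' ω ∧ TemperatureTendsto P β θ W J κ (J ω) (κ' ω))
    (hπ : ∀ᵐ ω ∂P, ∀ᶠ t in 𝓝 (pseudoTrue θ (J ω)), ContinuousAt π t ∧ 0 < π t)
    {ε : ℝ} (hε : 0 < ε) :
    Tendsto (fun n => P {ω | ε ≤ bvmDist T π (increments β θ W J n ω) (κ n ω)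
        (κ' ω) (pseudoTrue θ (J ω))}) atTop (𝓝 0) := by
  obtain ⟨g, hg, hgeq⟩ := exists_measurable_eq_pseudoTrue T θ
  obtain ⟨k, hk, hkeq⟩ := hκ'm.stronglyMeasurable_mk.measurable.exists_eq_measurable_comp
  have hgJ : ∀ᵐ ω ∂P, g (J ω) = pseudoTrue θ (J ω) := hJ.mono fun ω hω => hgeq _ hω
  have hkJ : ∀ᵐ ω ∂P, k (J ω) = κ' ω := by
    filter_upwards [hκ'm.ae_eq_mk] with ω hω
    rw [hω, hkeq]; rfl
  have hY : ∀ n, Measurable fun ω => (increments β θ W J n ω, κ n ω) := fun n =>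
    (measurable_increments hWm hJm n).prodMk (hκm n)
  have hmle : ∀ δ > 0, Tendsto (fun n => P {ω | δ ≤ |mle T (increments β θ W J n ω) - g (J ω)|})
      atTop (𝓝 0) := by
    intro δ hδ
    refine tendsto_measure_of_tendsto_condDistrib hJm hY
      (A := fun n => {p | δ ≤ |mle T p.2.1 - g p.1|})
      (fun n => measurableSet_le measurable_const (by fun_prop)) ?_
    filter_upwards [ae_tendsto_condLaw_mle hT β hθ hW hWm hJm hJ hWJ hκm, hgJ] with ω hω hgω
    have := hω δ hδ
    rw [← hgω] at this
    exact this
  have hκ : ∀ δ > 0, Tendsto (fun n => P {ω | δ ≤ |κ n ω - k (J ω)|}) atTop (𝓝 0) := by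
    intro δ hδ
    refine tendsto_measure_of_tendsto_condDistrib hJm hY
      (A := fun n => {p | δ ≤ |p.2.2 - k p.1|})
      (fun n => measurableSet_le measurable_const (by fun_prop)) ?_
    filter_upwards [hκ', hkJ] with ω hω hkω
    have := hω.2 δ hδ
    rw [← hkω] at this
    exact this
  have hpair : Measurable fun ω => (g (J ω), k (J ω)) := by fun_prop
  set ν := P.map fun ω => (g (J ω), k (J ω))
  have : IsProbabilityMeasure ν := Measure.isProbabilityMeasure_map hpair.aemeasurable
  set U : Set (ℝ × ℝ) := {p | 0 < p.1 ∧ 0 < p.2 ∧ ∀ᶠ t in 𝓝 p.1, ContinuousAt π t ∧ 0 < π t}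
  have hU : IsOpen U := (isOpen_lt continuous_const continuous_fst).inter
    ((isOpen_lt continuous_const continuous_snd).inter
      (isOpen_setOfPred_eventually_nhds.preimage continuous_fst))
  have hmemU : ∀ᵐ ω ∂P, (g (J ω), k (J ω)) ∈ U := by
    filter_upwards [hgJ, hkJ, hκ', hπ] with ω h1 h2 h3 h4
    rw [h1, h2]
    exact ⟨pseudoTrue_pos hθ _, h3.1, h4⟩
  rw [ENNReal.tendsto_nhds_zero]
  intro η hη
  have hη2 : 0 < η / 2 := ENNReal.half_pos hη.ne'
  obtain ⟨K, hKU, hK, hνK⟩ := hU.measurableSet.exists_isCompact_sdiff_lt (measure_ne_top ν U) hη2.ne'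
  rw [Measure.map_apply hpair (hU.measurableSet.diff hK.measurableSet)] at hνK
  obtain ⟨δ, hδ, N, hN⟩ := exists_forall_bvmDist_lt hT hπm hπ0 hπ1 hK (fun p hp => by
    obtain ⟨h1, h2, h3⟩ := hKU hp
    exact ⟨h1, h2, h3.self_of_nhds⟩) hε
  have hlim := (hmle δ hδ).add (hκ δ hδ)
  rw [add_zero] at hlim
  filter_upwards [eventually_ge_atTop N, ENNReal.tendsto_nhds_zero.mp hlim _ hη2] with n hn hsmall
  set A₁ := {ω | δ ≤ |mle T (increments β θ W J n ω) - g (J ω)|}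
  set A₂ := {ω | δ ≤ |κ n ω - k (J ω)|}
  set A₃ := (fun ω => (g (J ω), k (J ω))) ⁻¹' (U \ K)
  calc P {ω | ε ≤ bvmDist T π (increments β θ W J n ω) (κ n ω) (κ' ω) (pseudoTrue θ (J ω))}
      ≤ P ((A₁ ∪ A₂) ∪ A₃) := by
        refine measure_mono_ae ?_
        filter_upwards [hgJ, hkJ, hmemU] with ω h1 h2 h3 hω
        by_contra hnot
        change ¬ (ω ∈ (A₁ ∪ A₂) ∪ A₃) at hnot
        rw [Set.mem_union, Set.mem_union, not_or, not_or] at hnot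
        have hmemK : (g (J ω), k (J ω)) ∈ K := by
          by_contra hK'
          exact hnot.2 ⟨h3, hK'⟩
        have hlt := hN _ hmemK n hn (increments β θ W J n ω) (κ n ω) (not_le.mp hnot.1.1)
          (not_le.mp hnot.1.2)
        simp only [h1, h2] at hlt
        exact absurd hlt (not_lt.mpr hω)
    _ ≤ (P A₁ + P A₂) + P A₃ := (measure_union_le _ _).trans (by gcongr; exact measure_union_le _ _)
    _ ≤ η / 2 + η / 2 := add_le_add hsmall hνK.le
    _ = η := ENNReal.add_halves η

end JumpDiffusion

theorem theorem1 {Ω : Type*} [MeasurableSpace Ω] (P : Measure Ω) [IsProbabilityMeasure P]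
    (T : ℝ≥0) (hT : 0 < T) (β θ : ℝ) (hθ : 0 < θ)
    -- the standard Brownian motion
    (W : ℝ≥0 → Ω → ℝ) (hW : IsBrownianReal W P) (hWm : ∀ t, Measurable (W t))
    -- the jump process: almost surely of finite activity, and independent of `W`
    (J : Ω → Path T) (hJm : Measurable J) (hJ : ∀ᵐ ω ∂P, IsFiniteActivityPath (J ω))
    (hWJ : IndepFun (fun ω t => W t ω) J P)
    -- the stochastic temperature sequence
    (κ : ℕ → Ω → ℝ) (hκm : ∀ n, Measurable (κ n))
    -- the prior density on `(0, ∞)`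
    (π : ℝ → ℝ) (hπm : Measurable π) (hπ0 : ∀ t > 0, 0 ≤ π t)
    (hπ1 : ∫⁻ t in Set.Ioi 0, ENNReal.ofReal (π t) = 1) :
    -- conditionally on almost every jump path
    (∀ᵐ ω ∂P, ∀ κ' > 0, TemperatureTendsto P β θ W J κ (J ω) κ' →
      (∀ᶠ t in 𝓝 (pseudoTrue θ (J ω)), ContinuousAt π t ∧ 0 < π t) →
      ∀ ε > 0, Tendsto (fun n => condLaw P β θ W J κ n (J ω)
        {x | ε ≤ bvmDist T π x.1 x.2 κ' (pseudoTrue θ (J ω))}) atTop (𝓝 0)) ∧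
    -- unconditionally
    (∀ κ' : Ω → ℝ, AEStronglyMeasurable[MeasurableSpace.comap J inferInstance] κ' P →
      (∀ᵐ ω ∂P, 0 < κ' ω ∧ TemperatureTendsto P β θ W J κ (J ω) (κ' ω)) →
      (∀ᵐ ω ∂P, ∀ᶠ t in 𝓝 (pseudoTrue θ (J ω)), ContinuousAt π t ∧ 0 < π t) →
      ∀ ε > 0, Tendsto (fun n => P {ω | ε ≤ bvmDist T π (increments β θ W J n ω) (κ n ω)
        (κ' ω) (pseudoTrue θ (J ω))}) atTop (𝓝 0)) :=
  ⟨bernsteinVonMises_conditional hT β hθ hW hWm hJm hJ hWJ hκm hπm hπ0 hπ1,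
    fun _ hκ'm hκ' hπ _ hε => bernsteinVonMises_unconditional hT β hθ hW hWm hJm hJ hWJ hκm hπm hπ0
      hπ1 hκ'm hκ' hπ hε⟩
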